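/- Let $N\ge 1$, and let $\mathsf H$ be a trace-normalized Hamiltonian on $(0,L)$ (a locally summable $2\times2$ real matrix function with $\mathsf H\ge 0$, $\operatorname{tr}\mathsf H=1$ a.e.) which consists of $N+1$ consecutive indivisible intervals: on the $k$-th one, of length $l_k>0$, $\mathsf H=\langle\cdot,e_k\rangle e_k$ a.e. for a unit vector $e_k\in\mathbb R^2$, and this holds on no larger interval, $1\le k\le N+1$. For $v=(v^+,v^-)$ put $v^\perp=(-v^-,v^+)$, and let $\delta_k=-\langle e_k^\perp,e_{k+1}\rangle$ for $1\le k\le N$. The corresponding Jacobi matrix $J$ is the symmetric tridiagonal $N\times N$ matrix with diagonal $q_1,\dots,q_N$ and off-diagonal $\rho_1,\dots,\rho_{N-1}$ given by $$q_1=\frac1{l_1}\left(\frac{\langle e_1,e_2\rangle}{\langle e_1^\perp,e_2\rangle}-\frac{e_1^-}{e_1^+}\right),\qquad q_j=\frac1{l_j}\left(\frac{\langle e_j,e_{j+1}\rangle}{\langle e_j^\perp,e_{j+1}\rangle}+\frac{\langle e_{j-1},e_j\rangle}{\langle e_{j-1}^\perp,e_j\rangle}\right)\ (2\le j\le N),\qquad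 \rho_j=-\frac{1}{\sqrt{l_{j+1}l_j}\,\langle e_j^\perp,e_{j+1}\rangle}\ (1\le j\le N-1).$$ Its spectral data is the measure $\mu\ge0$ on $\mathbb R$ with $\int\frac{d\mu(t)}{1+t^2}<\infty$ in the Herglotz representation $\langle (J-z)^{-1}u,u\rangle=az+b+\int_{\mathbb R}\left(\frac1{t-z}-\frac t{1+t^2}\right)d\mu(t)$, $\operatorname{Im}z>0$, where $u=(1,0,\dots,0)^{\mathsf T}\in\mathbb R^N$, $a\ge0$ and $b\in\mathbb R$. Let $\lambda>1000$, $\varkappa>100$ and $\frac{10}{\lambda}<\theta<\frac1{100}$. Suppose that $e_1=(1,0)$, that $\langle e_n,e_{n+1}\rangle<0$ for $1\le n\le N$, that $\frac1{1001}<\delta_1<\frac1{1000}$, and that for all $1\le n\le N-1$ $$\frac{\delta_n}{\delta_{n+1}}>100\varkappa,\qquad \frac{l_{n+1}\delta_{n+1}}{l_n\delta_n}>100\lambda,\qquad \frac{l_{n+1}\delta_{n+1}^2}{l_n\delta_n^2}>100\theta^{-1}.$$ Then $\mu$ is completely lacunary with parameters $\lambda,\varkappa,\theta$: $\mu=\sum_{k=1}^N\mu_k\delta_{t_k}$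 (here $\delta_{t_k}$ is the unit point mass at $t_k$) with $\mu_k>0$, $t_k>0$ and, for $1\le k\le N-1$, $$t_{k+1}>\lambda t_k,\qquad \frac{\mu_{k+1}}{t_{k+1}}>\varkappa\frac{\mu_k}{t_k},\qquad \frac{\mu_{k+1}}{t_{k+1}^2}<\theta\frac{\mu_k}{t_k^2}.$$ -/

import Mathlib

open MeasureTheory Set

noncomputable section

namespace LacunaryJacobi

/-! ### Jacobi matrices, Herglotz functions, spectral data -/

/-- The finite Jacobi matrix with diagonal `q 1, …, q N` and off-diagonal `ρ 1, …, ρ (N - 1)`;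
the row with index `i : Fin N` is the row number `i + 1`. -/
def jacobiMatrix (N : ℕ) (q ρ : ℕ → ℝ) : Matrix (Fin N) (Fin N) ℝ :=
  fun i j =>
    if i = j then q ((i : ℕ) + 1)
    else if (j : ℕ) = (i : ℕ) + 1 then ρ ((i : ℕ) + 1)
    else if (i : ℕ) = (j : ℕ) + 1 then ρ ((j : ℕ) + 1)
    else 0

/-- The function `f(z) = ⟨(J - z)⁻¹ e₁, e₁⟩`, where `e₁` is the first standard basis vector. -/
def herglotz {N : ℕ} [NeZero N] (J : Matrix (Fin N) (Fin N) ℝ) (z : ℂ) : ℂ :=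
  (J.map Complex.ofReal - z • (1 : Matrix (Fin N) (Fin N) ℂ))⁻¹ 0 0

/-- `μ` is the spectral data (spectral measure) of `J`: the measure in the Herglotz
representation `f(z) = a z + b + ∫ (1 / (t - z) - t / (1 + t²)) dμ(t)`, `Im z > 0`, with `a ≥ 0`,
`b` real and `∫ dμ(t) / (1 + t²) < ∞`. -/
def IsSpectralData {N : ℕ} [NeZero N] (J : Matrix (Fin N) (Fin N) ℝ) (μ : Measure ℝ) : Prop :=
  Integrable (fun t : ℝ => 1 / (1 + t ^ 2)) μ ∧
  ∃ a b : ℝ, 0 ≤ a ∧ ∀ z : ℂ, 0 < z.im →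
    herglotz J z = a * z + b + ∫ t : ℝ, (1 / ((t : ℂ) - z) - (t : ℂ) / (1 + (t : ℂ) ^ 2)) ∂μ

/-- `μ = ∑_{k = 1}^N m_k δ_{t_k}`, with `m_k > 0` and `t_k > 0`, is completely lacunary with
parameters `lam`, `ϰ`, `θ`. -/
def IsCompletelyLacunary (lam ϰ θ : ℝ) (N : ℕ) (μ : Measure ℝ) : Prop :=
  ∃ t m : ℕ → ℝ,
    (∀ k ∈ Finset.Icc 1 N, 0 < t k ∧ 0 < m k) ∧
    μ = ∑ k ∈ Finset.Icc 1 N, ENNReal.ofReal (m k) • Measure.dirac (t k) ∧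
    ∀ k : ℕ, 1 ≤ k → k + 1 ≤ N →
      t (k + 1) > lam * t k ∧
      m (k + 1) / t (k + 1) > ϰ * (m k / t k) ∧
      m (k + 1) / t (k + 1) ^ 2 < θ * (m k / t k ^ 2)

/-! ### Hamiltonians of canonical systems, and indivisible intervals -/

/-- `H` is a trace-normalized Hamiltonian on `(0, L)`: locally summable, nonnegative, of trace one
almost everywhere. -/
structure IsHamiltonian (H : ℝ → Matrix (Fin 2) (Fin 2) ℝ) (L : ℝ) : Prop where
  pos : 0 < L
  locallyIntegrable : ∀ i j, LocallyIntegrableOn (fun x => H x i j) (Ioo 0 L)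
  posSemidef : ∀ᵐ x ∂(volume.restrict (Ioo 0 L)), (H x).PosSemidef
  trace_eq_one : ∀ᵐ x ∂(volume.restrict (Ioo 0 L)), (H x).trace = 1

/-- `H = ⟨·, e⟩ e` almost everywhere on `(a, b)`. -/
def HasDirectionOn (H : ℝ → Matrix (Fin 2) (Fin 2) ℝ) (a b : ℝ)
    (e : EuclideanSpace ℝ (Fin 2)) : Prop :=
  ∀ᵐ x ∂(volume.restrict (Ioo a b)), H x = Matrix.vecMulVec (fun i => e i) (fun i => e i)

/-- `(a, b)` is an indivisible interval, of direction `e`, of the Hamiltonian `H` on `(0, L)`. -/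
structure IsIndivisibleInterval (H : ℝ → Matrix (Fin 2) (Fin 2) ℝ) (L a b : ℝ)
    (e : EuclideanSpace ℝ (Fin 2)) : Prop where
  nonneg : 0 ≤ a
  lt : a < b
  le : b ≤ L
  direction : HasDirectionOn H a b e
  maximal : ∀ a' b' : ℝ, 0 ≤ a' → a' ≤ a → b ≤ b' → b' ≤ L →
    HasDirectionOn H a' b' e → a' = a ∧ b' = b

/-- The Hamiltonian `H` on `(0, L)` consists of `K` indivisible intervals; the `k`-th one from the
left (`1 ≤ k ≤ K`) has length `l k` and direction `e k`. -/
structure IsIndivisibleChain (H : ℝ → Matrix (Fin 2) (Fin 2) ℝ) (L : ℝ) (K : ℕ)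
    (l : ℕ → ℝ) (e : ℕ → EuclideanSpace ℝ (Fin 2)) : Prop where
  hamiltonian : IsHamiltonian H L
  total_length : ∑ j ∈ Finset.Icc 1 K, l j = L
  indivisible : ∀ k ∈ Finset.Icc 1 K,
    IsIndivisibleInterval H L (∑ j ∈ Finset.Icc 1 (k - 1), l j) (∑ j ∈ Finset.Icc 1 k, l j) (e k)

/-! ### The Jacobi matrix of a chain of indivisible intervals -/

/-- The vector `v^⊥ = (-v⁻, v⁺)` for `v = (v⁺, v⁻)`. -/
def perp (v : EuclideanSpace ℝ (Fin 2)) : EuclideanSpace ℝ (Fin 2) := !₂[-v 1, v 0]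

/-- The ratio `⟨u, v⟩ / ⟨u^⊥, v⟩`. -/
def cot (u v : EuclideanSpace ℝ (Fin 2)) : ℝ := inner ℝ u v / inner ℝ (perp u) v

/-- The diagonal entries of the Jacobi matrix of a chain of indivisible intervals. -/
def chainDiag (l : ℕ → ℝ) (e : ℕ → EuclideanSpace ℝ (Fin 2)) (j : ℕ) : ℝ :=
  if j = 1 then (1 / l 1) * (cot (e 1) (e 2) - e 1 1 / e 1 0)
  else (1 / l j) * (cot (e j) (e (j + 1)) + cot (e (j - 1)) (e j))

/-- The off-diagonal entries of the Jacobi matrix of a chain of indivisible intervals. -/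
def chainOffDiag (l : ℕ → ℝ) (e : ℕ → EuclideanSpace ℝ (Fin 2)) (j : ℕ) : ℝ :=
  -(1 / (Real.sqrt (l (j + 1) * l j) * inner ℝ (perp (e j)) (e (j + 1))))

/-- The `N × N` Jacobi matrix that corresponds to a chain of `N + 1` indivisible intervals. -/
def chainJacobi (N : ℕ) (l : ℕ → ℝ) (e : ℕ → EuclideanSpace ℝ (Fin 2)) :
    Matrix (Fin N) (Fin N) ℝ :=
  jacobiMatrix N (chainDiag l e) (chainOffDiag l e)

/-- `δ_k = -⟨e_k^⊥, e_{k+1}⟩`. -/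
def chainDelta (e : ℕ → EuclideanSpace ℝ (Fin 2)) (k : ℕ) : ℝ :=
  -inner ℝ (perp (e k)) (e (k + 1))

end LacunaryJacobi

end

/-! The Jacobi eigenvalue equation is the equation of a vibrating string in disguise. With masses `M
n = l (n+1) * (e (n+1) 0)^2` and gaps `g n = δ (n+1) / -(E (n+1) * E (n+2))`, `E k = e k 0`, the
substitution `chainVector` turns it into the recursion of `stringSol`, with a free left end and a
fixed right end (`chainJacobi_mulVec`). All directions stay close to the horizontal axis and
consecutive ones nearly reverse, so `M n ≈ l (n+1)` and `g n ≈ δ (n+1)`.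

The hypotheses make the gaps shrink fast and the products `M n * g n` grow fast, which decouples the
resonances. For each `j` there is an eigenvalue `t` with `t * M j * g j` between `1/2` and `2`
(`exists_eigenvalue`). Its eigenvector, normalized by amplitude 1 at the left end, is nearly
constant up to mass `j` and decays in the weighted norm beyond it (`amp_head`, `amp_decay`), so its
squared norm is comparable to `M j` (`sum_bounds`). The windows for different `j` are disjoint; thus
these are all `N` eigenvalues.

The weight at `t` is the squared first component over the squared norm, `m ≈ l 1 / M j`. Hence `t ≈
1 / (M j * g j)`, `m / t ≈ l 1 * g j` and `m / t^2 ≈ l 1 * M j * g j^2`. The three growth hypotheses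
are the three lacunarity conditions up to bounded factors, which the constant 100 absorbs
(`lacunary_step`). Finally `measure_eq_sum_dirac` identifies the Herglotz measure with these point
masses. -/

noncomputable section

namespace LacunaryJacobi

/-! ### Strings with finitely many masses -/

/-- Amplitude and slope of the solution of the string equation with masses `M` and gaps `g`
whose left end is free. -/
def stringSol (M g : ℕ → ℝ) (z : ℝ) : ℕ → ℝ × ℝ
  | 0 => (1, 0)
  | n + 1 =>
    ((stringSol M g z n).1 + g n * ((stringSol M g z n).2 - z * M n * (stringSol M g z n).1),
      (stringSol M g z n).2 - z * M n * (stringSol M g z n).1)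

/-- The amplitude at the `n`-th mass. -/
def amp (M g : ℕ → ℝ) (z : ℝ) (n : ℕ) : ℝ := (stringSol M g z n).1

/-- The slope to the left of the `n`-th mass. -/
def slope (M g : ℕ → ℝ) (z : ℝ) (n : ℕ) : ℝ := (stringSol M g z n).2

@[simp] theorem amp_zero (M g : ℕ → ℝ) (z : ℝ) : amp M g z 0 = 1 := rfl

@[simp] theorem slope_zero (M g : ℕ → ℝ) (z : ℝ) : slope M g z 0 = 0 := rfl

theorem slope_succ (M g : ℕ → ℝ) (z : ℝ) (n : ℕ) :
    slope M g z (n + 1) = slope M g z n - z * M n * amp M g z n := rfl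

theorem amp_succ (M g : ℕ → ℝ) (z : ℝ) (n : ℕ) :
    amp M g z (n + 1) = amp M g z n + g n * slope M g z (n + 1) := rfl

theorem continuous_stringSol (M g : ℕ → ℝ) (n : ℕ) : Continuous fun z => stringSol M g z n := by
  induction n with
  | zero => exact continuous_const
  | succ n ih =>
    simp only [stringSol]
    fun_prop

theorem continuous_amp (M g : ℕ → ℝ) (n : ℕ) : Continuous fun z => amp M g z n :=
  continuous_fst.comp (continuous_stringSol M g n)

/-- A string whose gaps decrease rapidly, while the products of masses and gaps increase
rapidly. -/
structure IsSparseString (N : ℕ) (M g : ℕ → ℝ) : Prop where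
  mass_pos : ∀ n < N, 0 < M n
  gap_pos : ∀ n < N, 0 < g n
  gap : ∀ n, n + 1 < N → 1000 * g (n + 1) ≤ g n
  moment : ∀ n, n + 1 < N → 1000 * (M n * g n) ≤ M (n + 1) * g (n + 1)

/-! ### Eigenvalues and eigenvectors of a sparse string -/

namespace IsSparseString

variable {N : ℕ} {M g : ℕ → ℝ}

theorem mass_le (h : IsSparseString N M g) {n : ℕ} (hn : n + 1 < N) :
    1000 * 1000 * M n ≤ M (n + 1) := by
  have hg := h.gap_pos (n + 1) hn
  have h1 := h.gap n hn
  have h2 := h.moment n hn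
  have h3 := h.mass_pos n (by omega)
  have h4 : 1000 * 1000 * M n * g (n + 1) ≤ M (n + 1) * g (n + 1) := by
    nlinarith [mul_le_mul_of_nonneg_left h1 h3.le]
  exact le_of_mul_le_mul_right h4 hg

theorem moment_le (h : IsSparseString N M g) {i j : ℕ} (hij : i ≤ j) (hj : j < N) :
    M i * g i ≤ M j * g j := by
  induction j, hij using Nat.le_induction with
  | base => exact le_rfl
  | succ j hij ih =>
    have := h.moment j hj
    have := mul_pos (h.mass_pos j (by omega)) (h.gap_pos j (by omega))
    have := ih (by omega)
    linarith

theorem moment_lt (h : IsSparseString N M g) {i j : ℕ} (hij : i < j) (hj : j < N) :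
    1000 * (M i * g i) ≤ M j * g j :=
  (h.moment i (by omega)).trans (h.moment_le hij hj)

/-- Up to the `j`-th mass, the solution is almost constant. -/
theorem amp_head (h : IsSparseString N M g) {j : ℕ} (hj : j < N) {z : ℝ} (hz : 0 < z)
    (hzj : z * (M j * g j) ≤ 2) {i : ℕ} (hi : i ≤ j) :
    1 - z * (M i * g i) / 100 ≤ amp M g z i ∧ amp M g z i ≤ 1 ∧
      0 ≤ -slope M g z i ∧ -slope M g z i ≤ z * M i / 1000 := by
  induction i with
  | zero =>
    have h1 := mul_pos (h.mass_pos 0 (by omega)) (h.gap_pos 0 (by omega))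
    have h2 := mul_pos hz h1
    have h3 := mul_pos hz (h.mass_pos 0 (by omega))
    simp only [amp_zero, slope_zero]
    refine ⟨by linarith, le_rfl, by simp, by linarith⟩
  | succ i ih =>
    obtain ⟨h1, h2, h3, h4⟩ := ih (by omega)
    have hM := h.mass_pos i (by omega)
    have hg := h.gap_pos i (by omega)
    have hx : z * (M i * g i) ≤ 2 :=
      (mul_le_mul_of_nonneg_left (h.moment_le (by omega : i ≤ j) hj) hz.le).trans hzj
    have hw : 0 ≤ amp M g z i := by linarith
    have hzM := mul_pos hz hM
    have h5 := h.mass_le (n := i) (by omega)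
    have h6 := h.moment i (by omega)
    have h7 : z * M i * amp M g z i ≤ z * M i := by nlinarith
    have h8 : 0 ≤ z * M i * amp M g z i := by positivity
    have h9 := mul_le_mul_of_nonneg_left h5 hz.le
    have h10 := mul_le_mul_of_nonneg_left h6 hz.le
    have hs : slope M g z (i + 1) = slope M g z i - z * M i * amp M g z i := slope_succ ..
    have ha := amp_succ M g z i
    have h11 : -slope M g z (i + 1) ≤ z * M i * 1.001 := by rw [hs]; linarith
    have h12 : 0 ≤ -slope M g z (i + 1) := by rw [hs]; linarith
    have h13 := mul_le_mul_of_nonneg_left h11 hg.le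
    have h14 := mul_nonneg hg.le h12
    have h15 : 0 ≤ z * (M i * g i) := by positivity
    -- With `x i = z * M i * g i`, crossing gap `i` costs at most `1.001 * x i`. The total loss
    -- `1.011 * x i` is below `x (i+1) / 100`, since `x` grows by a factor 1000. The slope bound
    -- survives because masses grow by `10^6`.
    refine ⟨?_, ?_, h12, ?_⟩
    · rw [ha]; nlinarith
    · rw [ha]; linarith
    · nlinarith

/-- Beyond the resonant mass the solution oscillates. -/
theorem amp_tail (h : IsSparseString N M g) {z : ℝ} {j : ℕ}
    (hx : ∀ n, j < n → n < N → 3 ≤ z * (M n * g n)) {s : ℝ} (hs : |s| = 1)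
    (h0 : 0 < s * (-1) ^ (j + 1) * amp M g z (j + 1))
    (h1 : j + 1 < N → g (j + 1) * |slope M g z (j + 1)| ≤ |amp M g z (j + 1)|)
    {n : ℕ} (hjn : j + 1 ≤ n) (hn : n ≤ N) :
    0 < s * (-1) ^ n * amp M g z n ∧
      (n < N → g n * |slope M g z n| ≤ |amp M g z n|) := by
  induction n, hjn using Nat.le_induction with
  | base => exact ⟨h0, h1⟩
  | succ n hjn ih =>
    obtain ⟨h2, h3⟩ := ih (by omega)
    have h3 := h3 (by omega)
    have hg := h.gap_pos n (by omega)
    have hxn := hx n (by omega) (by omega)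
    set w := amp M g z n with hw
    set b := slope M g z n with hb
    have hwe : amp M g z (n + 1) = w * (1 - z * (M n * g n)) + g n * b := by
      rw [amp_succ, slope_succ]; ring
    set σ := s * (-1) ^ n with hσ
    have hσ1 : |σ| = 1 := by rw [hσ, abs_mul, hs, abs_pow]; simp
    have hwabs : |w| = σ * w := by
      rw [← abs_of_pos h2, abs_mul, hσ1, one_mul]
    have hgb : |σ * (g n * b)| ≤ σ * w := by
      rw [abs_mul, hσ1, one_mul, abs_mul, abs_of_pos hg, ← hwabs]; exact h3
    -- Since `z * M n * g n ≥ 3`, the left side of the recursion flips sign by at least `2 * σ * w`,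
    -- of which the incoming slope can undo at most `σ * w`.
    have h4 : σ * w ≤ -σ * amp M g z (n + 1) := by
      have := (abs_le.1 hgb).2
      rw [hwe]
      nlinarith
    have h5 : s * (-1) ^ (n + 1) * amp M g z (n + 1) = -σ * amp M g z (n + 1) := by
      rw [hσ, pow_succ]; ring
    refine ⟨by rw [h5]; linarith, fun hn1 => ?_⟩
    have h6 := h.gap n hn1
    have h7 : |amp M g z (n + 1)| = -σ * amp M g z (n + 1) := by
      rw [← abs_of_pos (h2.trans_le h4), abs_mul, abs_neg, hσ1, one_mul]
    have h8 : g n * slope M g z (n + 1) = amp M g z (n + 1) - w := by rw [amp_succ]; ring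
    have h8' : |amp M g z (n + 1) - w| = g n * |slope M g z (n + 1)| := by
      rw [← h8, abs_mul, abs_of_pos hg]
    have h9 : g n * |slope M g z (n + 1)| ≤ |amp M g z (n + 1)| + |w| := by
      rw [← h8']; exact abs_sub _ _
    have h10 := mul_le_mul_of_nonneg_right h6 (abs_nonneg (slope M g z (n + 1)))
    have h11 : |w| ≤ |amp M g z (n + 1)| := by rw [h7, hwabs]; exact h4
    have := abs_nonneg (amp M g z (n + 1))
    nlinarith

/-- The sign of the solution at the right end, for a spectral parameter away from the
resonances. -/
theorem amp_sign (h : IsSparseString N M g) {j : ℕ} (hj : j < N) {z : ℝ} (hz : 0 < z)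
    (hzj : z * (M j * g j) = 1 / 2 ∨ z * (M j * g j) = 2) :
    0 < (if z * (M j * g j) = 2 then -1 else 1) * (-1) ^ (j + 1) * (-1) ^ N * amp M g z N := by
  have hle : z * (M j * g j) ≤ 2 := by rcases hzj with h | h <;> linarith
  have hge : 1 / 2 ≤ z * (M j * g j) := by rcases hzj with h | h <;> linarith
  obtain ⟨h1, h2, h3, h4⟩ := h.amp_head hj hz hle le_rfl
  have hg := h.gap_pos j hj
  have hwe : amp M g z (j + 1) = amp M g z j * (1 - z * (M j * g j)) + g j * slope M g z j := by
    rw [amp_succ, slope_succ]; ring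
  have hb1 := mul_le_mul_of_nonneg_left h4 hg.le
  have hb2 := mul_nonneg hg.le h3
  set s : ℝ := (if z * (M j * g j) = 2 then -1 else 1) with hs
  have hs1 : |s| = 1 := by rw [hs]; split_ifs <;> simp
  -- The factor `1 - z * M j * g j` is `1/2` or `-1`, while the incoming slope contributes at most
  -- `0.002` in modulus.
  have hpos : 0.4 ≤ s * amp M g z (j + 1) := by
    rcases hzj with hx | hx
    · rw [hs, if_neg (by rw [hx]; norm_num), hwe, hx]
      rw [hx] at h1
      nlinarith
    · rw [hs, if_pos hx, hwe, hx]
      rw [hx] at h1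
      nlinarith
  have habs : |amp M g z (j + 1)| = s * amp M g z (j + 1) := by
    rw [← abs_of_pos (lt_of_lt_of_le (by norm_num) hpos), abs_mul, hs1, one_mul]
  have hpp : ((-1 : ℝ) ^ (j + 1)) * (-1) ^ (j + 1) = 1 := by
    rw [← mul_pow]; simp
  refine (h.amp_tail (s := s * (-1) ^ (j + 1)) (j := j) (n := N) ?_ ?_ ?_ ?_ hj le_rfl).1
  · intro n hjn hn
    have := mul_le_mul_of_nonneg_left (h.moment_lt hjn hn) hz.le
    linarith
  · rw [abs_mul, hs1, abs_pow]; simp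
  · rw [mul_assoc s, hpp]; linarith
  · intro hj1
    have h6 := h.gap j hj1
    have h8 : g j * slope M g z (j + 1) = amp M g z (j + 1) - amp M g z j := by
      rw [amp_succ]; ring
    have h8' : |amp M g z (j + 1) - amp M g z j| = g j * |slope M g z (j + 1)| := by
      rw [← h8, abs_mul, abs_of_pos hg]
    have h9 : g j * |slope M g z (j + 1)| ≤ |amp M g z (j + 1)| + |amp M g z j| := by
      rw [← h8']; exact abs_sub _ _
    have h10 := mul_le_mul_of_nonneg_right h6 (abs_nonneg (slope M g z (j + 1)))
    have h11 : |amp M g z j| ≤ 1 := abs_le.2 ⟨by linarith, h2⟩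
    rw [habs] at h9 ⊢
    linarith

/-- As `z` crosses the window, only the step over mass `j` changes its sign behaviour; every later
mass flips the sign at both ends of the window. So the terminal amplitude has opposite signs there,
and the intermediate value theorem applies. -/
theorem exists_eigenvalue (h : IsSparseString N M g) {j : ℕ} (hj : j < N) :
    ∃ z, 1 / 2 ≤ z * (M j * g j) ∧ z * (M j * g j) ≤ 2 ∧ amp M g z N = 0 := by
  have ha := mul_pos (h.mass_pos j hj) (h.gap_pos j hj)
  set a := M j * g j with hadef
  have e1 : 1 / 2 / a * a = 1 / 2 := div_mul_cancel₀ _ ha.ne'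
  have e2 : 2 / a * a = 2 := div_mul_cancel₀ _ ha.ne'
  have hs1 := h.amp_sign hj (z := 1 / 2 / a) (by positivity) (Or.inl e1)
  have hs2 := h.amp_sign hj (z := 2 / a) (by positivity) (Or.inr e2)
  rw [← hadef, e1, if_neg (by norm_num)] at hs1
  rw [← hadef, e2, if_pos rfl] at hs2
  have hle : 1 / 2 / a ≤ 2 / a := by gcongr; norm_num
  set c : ℝ := (-1) ^ (j + 1) * (-1) ^ N with hc
  have hc0 : c ≠ 0 := by rw [hc]; positivity
  have hcont : ContinuousOn (fun z => c * amp M g z N) (Icc (1 / 2 / a) (2 / a)) :=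
    (continuous_const.mul (continuous_amp M g N)).continuousOn
  have := intermediate_value_Icc' hle hcont
  obtain ⟨z, hz, hz0⟩ := this (show (0 : ℝ) ∈ _ from ⟨by rw [hc]; linarith, by rw [hc]; linarith⟩)
  refine ⟨z, ?_, ?_, (mul_eq_zero.1 hz0).resolve_left hc0⟩
  · rw [← e1]; exact mul_le_mul_of_nonneg_right hz.1 ha.le
  · rw [← e2]; exact mul_le_mul_of_nonneg_right hz.2 ha.le

/-- Beyond the resonant mass, an eigenvector decays. -/
theorem amp_decay (h : IsSparseString N M g) {z : ℝ} {j : ℕ} (hz : 0 < z)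
    (hzj : 1 / 2 ≤ z * (M j * g j)) (hN : amp M g z N = 0) {n : ℕ} (hjn : j ≤ n)
    (hn : n + 1 ≤ N) :
    |amp M g z (n + 1)| ≤ |amp M g z n| ∧
      (n + 1 < N → M (n + 1) * amp M g z (n + 1) ^ 2 ≤ M n * amp M g z n ^ 2 / 2) := by
  -- Backward induction from the fixed end, where the amplitude is zero: the bound at `n` uses the
  -- one at `n + 1`.
  induction hd : N - (n + 1) generalizing n with
  | zero =>
    have : n + 1 = N := by omega
    rw [this, hN]
    simp
  | succ d ih =>
    have hn1 : n + 1 < N := by omega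
    have h2 := (ih (n := n + 1) (by omega) (by omega) (by omega)).1
    have hx : 500 ≤ z * (M (n + 1) * g (n + 1)) := by
      have := mul_le_mul_of_nonneg_left (h.moment_lt (by omega : j < n + 1) hn1) hz.le
      linarith
    have hx0 : 1 / 2 ≤ z * (M n * g n) := by
      have := mul_le_mul_of_nonneg_left (h.moment_le hjn (by omega : n < N)) hz.le
      linarith
    have hg := h.gap_pos n (by omega)
    have hg1 := h.gap_pos (n + 1) hn1
    have hM1 := h.mass_pos (n + 1) hn1
    have hM := h.mass_pos n (by omega)
    have hgap := h.gap n hn1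
    set w := amp M g z n
    set w1 := amp M g z (n + 1) with hw1
    set w2 := amp M g z (n + 1 + 1) with hw2
    set x := z * (M (n + 1) * g (n + 1)) with hxdef
    have e1 : w2 = w1 * (1 - x) + g (n + 1) * slope M g z (n + 1) := by
      rw [hw2, amp_succ, slope_succ]; ring
    have e2 : g n * slope M g z (n + 1) = w1 - w := by rw [hw1, amp_succ]; ring
    -- multiply the recursion by `g n`
    have e3 : g n * (w1 * (x - 1)) = g (n + 1) * (w1 - w) - g n * w2 := by
      rw [← e2, e1]; ring
    have e4 : g n * (|w1| * (x - 1)) ≤ g (n + 1) * (|w1| + |w|) + g n * |w2| := by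
      calc g n * (|w1| * (x - 1)) = |g n * (w1 * (x - 1))| := by
            rw [abs_mul, abs_mul, abs_of_pos hg, abs_of_pos (by linarith : (0 : ℝ) < x - 1)]
        _ = |g (n + 1) * (w1 - w) - g n * w2| := by rw [e3]
        _ ≤ |g (n + 1) * (w1 - w)| + |g n * w2| := abs_sub _ _
        _ ≤ _ := by
            rw [abs_mul, abs_mul, abs_of_pos hg, abs_of_pos hg1]
            gcongr
            exact abs_sub _ _
    have p1 := abs_nonneg w1
    have p0 := abs_nonneg w
    have e5 : g n * |w1| * x ≤ 2 * g (n + 1) * |w| := by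
      have f1 := mul_le_mul_of_nonneg_left h2 hg.le
      have f2 := mul_le_mul_of_nonneg_right hgap p1
      have f3 : 500 * (g n * |w1|) ≤ x * (g n * |w1|) :=
        mul_le_mul_of_nonneg_right hx (by positivity)
      nlinarith
    have e6 : 500 * |w1| ≤ |w| := by
      have f3 : 500 * (g n * |w1|) ≤ x * (g n * |w1|) :=
        mul_le_mul_of_nonneg_right hx (by positivity)
      have f2 := mul_le_mul_of_nonneg_right hgap p0
      have : g n * (500 * |w1|) ≤ g n * |w| := by nlinarith
      exact le_of_mul_le_mul_left this hg
    refine ⟨by linarith, fun _ => ?_⟩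
    rw [← sq_abs w, ← sq_abs w1]
    -- `x = z M₁ g₁`, so the bound on `|w1|` controls `M₁ |w1|`
    have e7 : z * M (n + 1) * g n * |w1| ≤ 2 * |w| := by
      have : g (n + 1) * (z * M (n + 1) * g n * |w1|) ≤ g (n + 1) * (2 * |w|) := by
        rw [hxdef] at e5; nlinarith
      exact le_of_mul_le_mul_left this hg1
    -- The bound `e6` alone is not enough, as `M (n+1) / M n` may be arbitrarily large. Multiplying
    -- it by `e7` bounds the left side by `|w|^2 / 250`, and `hx0` gives `|w|^2 ≤ 2 * z * M n * g n
    -- * |w|^2`.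
    have e8 : z * g n * (M (n + 1) * |w1| ^ 2) ≤ z * g n * (M n * |w| ^ 2 / 2) := by
      have f1 := mul_le_mul e7 e6 (by positivity) (by positivity)
      have f2 := mul_le_mul_of_nonneg_right hx0 (sq_nonneg |w|)
      nlinarith [sq_nonneg |w|]
    exact le_of_mul_le_mul_left e8 (by positivity)

theorem sum_head (h : IsSparseString N M g) {j : ℕ} (hj : j < N) {z : ℝ} (hz : 0 < z)
    (hzj : z * (M j * g j) ≤ 2) {i : ℕ} (hi : i ≤ j) :
    ∑ k ∈ Finset.range i, M k * amp M g z k ^ 2 ≤ M i / 1000 := by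
  induction i with
  | zero =>
    have := h.mass_pos 0 (by omega)
    simp; positivity
  | succ i ih =>
    rw [Finset.sum_range_succ]
    have h1 := ih (by omega)
    obtain ⟨h2, h3, -, -⟩ := h.amp_head hj hz hzj (by omega : i ≤ j)
    have hx : z * (M i * g i) ≤ 2 :=
      (mul_le_mul_of_nonneg_left (h.moment_le (by omega : i ≤ j) hj) hz.le).trans hzj
    have h4 : amp M g z i ^ 2 ≤ 1 := pow_le_one₀ (by linarith) h3
    have h5 := h.mass_le (n := i) (by omega)
    have h6 := h.mass_pos i (by omega)
    nlinarith

/-- The subtracted last term closes the induction: each new summand is at most half of its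
predecessor. -/
theorem sum_tail (h : IsSparseString N M g) {z : ℝ} {j : ℕ} (hz : 0 < z)
    (hzj : 1 / 2 ≤ z * (M j * g j)) (hN : amp M g z N = 0) {n : ℕ} (hjn : j ≤ n) (hn : n < N) :
    ∑ k ∈ Finset.range (n + 1), M k * amp M g z k ^ 2 ≤
      ∑ k ∈ Finset.range j, M k * amp M g z k ^ 2 + 2 * (M j * amp M g z j ^ 2)
        - M n * amp M g z n ^ 2 := by
  induction n, hjn using Nat.le_induction with
  | base => rw [Finset.sum_range_succ]; linarith
  | succ n hjn ih =>
    rw [Finset.sum_range_succ]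
    have h1 := ih (by omega)
    have h2 := (h.amp_decay hz hzj hN hjn (by omega)).2 hn
    linarith

/-- The norm of an eigenvector is comparable to the resonant mass. -/
theorem sum_bounds (h : IsSparseString N M g) {z : ℝ} {j : ℕ} (hj : j < N)
    (hzj : 1 / 2 ≤ z * (M j * g j)) (hzj' : z * (M j * g j) ≤ 2) (hN : amp M g z N = 0) :
    0.9 * M j ≤ ∑ k ∈ Finset.range N, M k * amp M g z k ^ 2 ∧
      ∑ k ∈ Finset.range N, M k * amp M g z k ^ 2 ≤ 2.1 * M j := by
  have ha := mul_pos (h.mass_pos j hj) (h.gap_pos j hj)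
  have hz : 0 < z := by
    by_contra hcon
    nlinarith
  have hM := h.mass_pos j hj
  obtain ⟨h1, h2, -, -⟩ := h.amp_head hj hz hzj' le_rfl
  have h3 : 0.98 ≤ amp M g z j := by linarith
  constructor
  · have : M j * amp M g z j ^ 2 ≤ ∑ k ∈ Finset.range N, M k * amp M g z k ^ 2 :=
      Finset.single_le_sum (f := fun k => M k * amp M g z k ^ 2)
        (fun k hk => mul_nonneg (h.mass_pos k (Finset.mem_range.1 hk)).le (sq_nonneg _))
        (Finset.mem_range.2 hj)
    have h4 : 0.9 ≤ amp M g z j ^ 2 := by nlinarith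
    nlinarith
  · obtain ⟨n, rfl⟩ : ∃ n, N = n + 1 := ⟨N - 1, by omega⟩
    have h4 := h.sum_tail hz hzj hN (by omega : j ≤ n) (by omega)
    have h5 := h.sum_head hj hz hzj' le_rfl
    have h6 : amp M g z j ^ 2 ≤ 1 := pow_le_one₀ (by linarith) h2
    have h7 : 0 ≤ M n * amp M g z n ^ 2 :=
      mul_nonneg (h.mass_pos n (by omega)).le (sq_nonneg _)
    nlinarith

end IsSparseString

/-! ### Symmetric matrices with simple spectrum -/

open Matrix in
/-- Partial fraction decomposition of the Herglotz function of a symmetric matrix with a full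
system of eigenvectors for distinct eigenvalues. -/
theorem herglotz_eq_sum {N : ℕ} [NeZero N] {J : Matrix (Fin N) (Fin N) ℝ} (hJ : Jᵀ = J)
    {τ : Fin N → ℝ} (hτ : Function.Injective τ) {v : Fin N → Fin N → ℝ}
    (hv : ∀ k, J *ᵥ v k = τ k • v k) (hpos : ∀ k, 0 < v k ⬝ᵥ v k) {z : ℂ} (hz : 0 < z.im) :
    herglotz J z = ∑ k, ((v k 0 ^ 2 / (v k ⬝ᵥ v k) : ℝ) : ℂ) / ((τ k : ℂ) - z) := by
  have horth : ∀ k l, k ≠ l → v k ⬝ᵥ v l = 0 := by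
    intro k l hkl
    have h1 : (J *ᵥ v k) ⬝ᵥ v l = v k ⬝ᵥ (J *ᵥ v l) := by
      rw [dotProduct_mulVec, ← mulVec_transpose, hJ]
    rw [hv, hv, smul_dotProduct, dotProduct_smul, smul_eq_mul, smul_eq_mul] at h1
    have h2 : (τ k - τ l) * (v k ⬝ᵥ v l) = 0 := by linarith
    exact (mul_eq_zero.1 h2).resolve_left (sub_ne_zero.2 fun h => hkl (hτ h))
  set S : Fin N → ℂ := fun k => ((v k ⬝ᵥ v k : ℝ) : ℂ) with hS
  have hS0 : ∀ k, S k ≠ 0 := fun k => Complex.ofReal_ne_zero.2 (hpos k).ne'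
  have hz0 : ∀ k, (τ k : ℂ) - z ≠ 0 := fun k h => by
    have := congrArg Complex.im h
    simp at this
    linarith
  set U : Matrix (Fin N) (Fin N) ℂ := Matrix.of fun k i => (v k i : ℂ) with hU
  have hUU : U * Uᵀ = diagonal S := by
    ext k l
    have h1 : (U * Uᵀ) k l = ((v k ⬝ᵥ v l : ℝ) : ℂ) := by
      simp [Matrix.mul_apply, dotProduct, hU]
    rw [h1]
    by_cases hkl : k = l
    · subst hkl; simp [hS]
    · rw [horth k l hkl, diagonal_apply_ne _ hkl, Complex.ofReal_zero]
  -- A one-sided inverse of a square matrix is two-sided, so orthogonality of the eigenvectors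
  -- yields completeness.
  have hcomplete : Uᵀ * diagonal (fun k => (S k)⁻¹) * U = 1 := by
    rw [Matrix.mul_assoc, mul_eq_one_comm, Matrix.mul_assoc, hUU, diagonal_mul_diagonal,
      ← diagonal_one]
    congr 1
    exact funext fun k => inv_mul_cancel₀ (hS0 k)
  have hJU : (J.map Complex.ofReal - z • (1 : Matrix (Fin N) (Fin N) ℂ)) * Uᵀ =
      Uᵀ * diagonal (fun k => (τ k : ℂ) - z) := by
    rw [Matrix.sub_mul, Matrix.smul_mul, Matrix.one_mul]
    ext i k
    have h1 := congrArg Complex.ofReal (congrFun (hv k) i)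
    simp only [mulVec, dotProduct, Complex.ofReal_sum, Complex.ofReal_mul, Pi.smul_apply,
      smul_eq_mul] at h1
    rw [mul_diagonal]
    simp only [Matrix.sub_apply, Matrix.smul_apply, Matrix.mul_apply, Matrix.map_apply,
      Matrix.transpose_apply, Matrix.of_apply, hU, smul_eq_mul]
    rw [h1]
    ring
  have hinv : (J.map Complex.ofReal - z • (1 : Matrix (Fin N) (Fin N) ℂ))⁻¹ =
      Uᵀ * diagonal (fun k => (S k * ((τ k : ℂ) - z))⁻¹) * U := by
    refine Matrix.inv_eq_right_inv ?_
    rw [← Matrix.mul_assoc, ← Matrix.mul_assoc, hJU, Matrix.mul_assoc Uᵀ, diagonal_mul_diagonal,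
      ← hcomplete]
    congr 3
    funext k
    have := hS0 k
    have := hz0 k
    field_simp
  rw [herglotz, hinv, Matrix.mul_apply]
  refine Finset.sum_congr rfl fun k _ => ?_
  have := hS0 k
  have := hz0 k
  rw [mul_diagonal, Matrix.transpose_apply]
  push_cast
  change _ = (v k 0 : ℂ) ^ 2 / S k / _
  simp only [hU, Matrix.of_apply]
  field_simp

theorem jacobiMatrix_transpose (N : ℕ) (q ρ : ℕ → ℝ) :
    (jacobiMatrix N q ρ).transpose = jacobiMatrix N q ρ := by
  ext i j
  simp only [Matrix.transpose_apply, jacobiMatrix, Fin.ext_iff]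
  split_ifs <;> first | rfl | omega | simp_all

/-- Action of a Jacobi matrix on a vector that is continued by zero at the right end. -/
theorem jacobiMatrix_mulVec {N : ℕ} (q ρ u : ℕ → ℝ) (hu : u N = 0) (i : Fin N) :
    (jacobiMatrix N q ρ).mulVec (fun j => u j) i =
      q (i + 1) * u i + ρ (i + 1) * u (i + 1) +
        if (i : ℕ) = 0 then 0 else ρ i * u (i - 1) := by
  -- At `i = 0` the truncated `i - 1` equals 0 and matches `j = 0`; the inner `if` kills that term.
  have hentry : ∀ j : Fin N, jacobiMatrix N q ρ i j * u j =
      (if (i : ℕ) = (j : ℕ) then q (i + 1) * u i else 0) +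
        (if (i : ℕ) + 1 = (j : ℕ) then ρ (i + 1) * u (i + 1) else 0) +
        (if (i : ℕ) - 1 = (j : ℕ) then (if (i : ℕ) = 0 then 0 else ρ i * u (i - 1)) else 0) := by
    intro j
    obtain ⟨i, hi⟩ := i
    obtain ⟨j, hj⟩ := j
    simp only [jacobiMatrix, Fin.mk.injEq]
    rcases lt_trichotomy i j with h | rfl | h
    · rw [if_neg h.ne, if_neg h.ne, if_neg (by omega : ¬ i = j + 1),
        if_neg (by omega : ¬ i - 1 = j)]
      by_cases h1 : j = i + 1
      · subst h1; simp
      · rw [if_neg h1, if_neg (by omega : ¬ i + 1 = j)]; ring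
    · rw [if_pos rfl, if_pos rfl, if_neg (by omega : ¬ i + 1 = i)]
      by_cases h1 : i = 0
      · simp [h1]
      · rw [if_neg (by omega : ¬ i - 1 = i)]; ring
    · rw [if_neg h.ne', if_neg h.ne', if_neg (by omega : ¬ j = i + 1),
        if_neg (by omega : ¬ i + 1 = j), if_neg (by omega : ¬ i = 0)]
      by_cases h1 : i = j + 1
      · subst h1; simp
      · rw [if_neg h1, if_neg (by omega : ¬ i - 1 = j)]; ring
  have hi := i.2
  simp only [Matrix.mulVec, dotProduct, hentry]
  rw [Fin.sum_univ_eq_sum_range (fun j => (if (i : ℕ) = j then q (i + 1) * u i else 0) +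
        (if (i : ℕ) + 1 = j then ρ (i + 1) * u (i + 1) else 0) +
        (if (i : ℕ) - 1 = j then (if (i : ℕ) = 0 then 0 else ρ i * u (i - 1)) else 0)) N,
    Finset.sum_add_distrib, Finset.sum_add_distrib, Finset.sum_ite_eq, Finset.sum_ite_eq,
    Finset.sum_ite_eq, if_pos (Finset.mem_range.2 hi),
    if_pos (Finset.mem_range.2 (by omega : (i : ℕ) - 1 < N))]
  congr 2
  by_cases h : (i : ℕ) + 1 < N
  · rw [if_pos (Finset.mem_range.2 h)]
  · rw [show (i : ℕ) + 1 = N by omega, hu]; simp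

/-! ### Uniqueness of the measure in the Herglotz representation of a rational function -/

/-- Splits off the `μ`-integrable factor `1 / (1 + t^2)`; the remaining factor is bounded in `t`. -/
theorem herglotzKernel_eq {z : ℂ} (hz : 0 < z.im) (t : ℝ) :
    1 / ((t : ℂ) - z) - (t : ℂ) / (1 + (t : ℂ) ^ 2) =
      (z + (1 + z ^ 2) / ((t : ℂ) - z)) * ((1 / (1 + t ^ 2) : ℝ) : ℂ) := by
  have h1 : (t : ℂ) - z ≠ 0 := fun h => by
    have := congrArg Complex.im h
    simp at this
    linarith
  have h2 : (1 : ℂ) + (t : ℂ) ^ 2 ≠ 0 := by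
    have : (0 : ℝ) < 1 + t ^ 2 := by positivity
    exact_mod_cast this.ne'
  push_cast
  field_simp
  ring

theorem integrable_herglotzKernel {μ : Measure ℝ}
    (hμ : Integrable (fun t : ℝ => 1 / (1 + t ^ 2)) μ) {z : ℂ} (hz : 0 < z.im) :
    Integrable (fun t : ℝ => 1 / ((t : ℂ) - z) - (t : ℂ) / (1 + (t : ℂ) ^ 2)) μ := by
  have h0 : ∀ t : ℝ, (t : ℂ) - z ≠ 0 := fun t h => by
    have := congrArg Complex.im h
    simp at this
    linarith
  have hcont : Continuous fun t : ℝ => z + (1 + z ^ 2) / ((t : ℂ) - z) :=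
    continuous_const.add (continuous_const.div (by fun_prop) h0)
  simp_rw [herglotzKernel_eq hz]
  refine (hμ.ofReal (𝕜 := ℂ)).bdd_mul (c := ‖z‖ + ‖1 + z ^ 2‖ / z.im) hcont.aestronglyMeasurable ?_
  filter_upwards with t
  refine (norm_add_le _ _).trans ?_
  rw [norm_div]
  have : z.im ≤ ‖(t : ℂ) - z‖ := by
    have := Complex.abs_im_le_norm ((t : ℂ) - z)
    simp at this
    exact (le_abs_self _).trans this
  gcongr

theorem herglotzKernel_im {y : ℝ} (x t : ℝ) :
    (1 / ((t : ℂ) - (x + y * Complex.I)) - (t : ℂ) / (1 + (t : ℂ) ^ 2)).im =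
      y / ((t - x) ^ 2 + y ^ 2) := by
  have : (t : ℂ) / (1 + (t : ℂ) ^ 2) = ((t / (1 + t ^ 2) : ℝ) : ℂ) := by push_cast; rfl
  rw [this, Complex.sub_im, Complex.ofReal_im, sub_zero, one_div, Complex.inv_im,
    Complex.normSq_apply]
  simp
  ring_nf

theorem inv_sub_im (c y x t : ℝ) :
    ((c : ℂ) / ((t : ℂ) - (x + y * Complex.I))).im = c * (y / ((t - x) ^ 2 + y ^ 2)) := by
  rw [div_eq_mul_inv, Complex.im_ofReal_mul, Complex.inv_im, Complex.normSq_apply]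
  congr 1
  simp
  ring_nf

theorem integrable_poisson {μ : Measure ℝ}
    (hμ : Integrable (fun t : ℝ => 1 / (1 + t ^ 2)) μ) (x : ℝ) {y : ℝ} (hy : 0 < y) :
    Integrable (fun t : ℝ => y / ((t - x) ^ 2 + y ^ 2)) μ := by
  have h := (integrable_herglotzKernel hμ (z := x + y * Complex.I) (by simpa using hy)).im
  exact h.congr (Filter.Eventually.of_forall fun t => herglotzKernel_im x t)

section

variable {ι : Type*} {s : Finset ι} {τ w : ι → ℝ} {μ : Measure ℝ} {a b : ℝ}

/-- The imaginary part of the Herglotz representation. -/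
theorem poisson_eq (hμ : Integrable (fun t : ℝ => 1 / (1 + t ^ 2)) μ)
    (hf : ∀ z : ℂ, 0 < z.im → ∑ k ∈ s, (w k : ℂ) / ((τ k : ℂ) - z) =
      a * z + b + ∫ t : ℝ, (1 / ((t : ℂ) - z) - (t : ℂ) / (1 + (t : ℂ) ^ 2)) ∂μ)
    (x : ℝ) {y : ℝ} (hy : 0 < y) :
    ∑ k ∈ s, w k * (y / ((τ k - x) ^ 2 + y ^ 2)) =
      a * y + ∫ t, y / ((t - x) ^ 2 + y ^ 2) ∂μ := by
  have hz : 0 < ((x : ℂ) + y * Complex.I).im := by simpa using hy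
  have h := congrArg Complex.im (hf _ hz)
  have hi := integrable_herglotzKernel hμ hz
  have h2 := Complex.imCLM.integral_comp_comm hi
  simp only [Complex.imCLM_apply, herglotzKernel_im] at h2
  rw [Complex.im_sum, Complex.add_im, ← h2] at h
  simp only [inv_sub_im] at h
  rw [h]
  simp

/-- On this interval the Poisson kernel is at least `1 / (2 * y)`. Markov's inequality then bounds
the measure by the Poisson integral, in which the term `a * y ≥ 0` may be dropped. -/
theorem measure_Icc_le (hμ : Integrable (fun t : ℝ => 1 / (1 + t ^ 2)) μ) (ha : 0 ≤ a)
    (hf : ∀ z : ℂ, 0 < z.im → ∑ k ∈ s, (w k : ℂ) / ((τ k : ℂ) - z) =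
      a * z + b + ∫ t : ℝ, (1 / ((t : ℂ) - z) - (t : ℂ) / (1 + (t : ℂ) ^ 2)) ∂μ)
    (x : ℝ) {y : ℝ} (hy : 0 < y) :
    μ (Icc (x - y) (x + y)) ≤
      ENNReal.ofReal (2 * y * ∑ k ∈ s, w k * (y / ((τ k - x) ^ 2 + y ^ 2))) := by
  have hint := integrable_poisson hμ x hy
  have hnn : ∀ t : ℝ, 0 ≤ y / ((t - x) ^ 2 + y ^ 2) := fun t => by positivity
  have hsub : Icc (x - y) (x + y) ⊆
      {t | ENNReal.ofReal (1 / (2 * y)) ≤ ENNReal.ofReal (y / ((t - x) ^ 2 + y ^ 2))} := by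
    rintro t ⟨h1, h2⟩
    apply ENNReal.ofReal_le_ofReal
    rw [div_le_div_iff₀ (by positivity) (by positivity)]
    nlinarith
  have hmk := mul_meas_ge_le_lintegral₀ (μ := μ)
    (f := fun t => ENNReal.ofReal (y / ((t - x) ^ 2 + y ^ 2)))
    hint.aestronglyMeasurable.aemeasurable.ennreal_ofReal (ENNReal.ofReal (1 / (2 * y)))
  rw [← ofReal_integral_eq_lintegral_ofReal hint (Filter.Eventually.of_forall hnn)] at hmk
  have hle : ∫ t, y / ((t - x) ^ 2 + y ^ 2) ∂μ ≤
      ∑ k ∈ s, w k * (y / ((τ k - x) ^ 2 + y ^ 2)) := by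
    rw [poisson_eq hμ hf x hy]
    have := mul_nonneg ha hy.le
    linarith
  have h1 : ENNReal.ofReal (1 / (2 * y)) * μ (Icc (x - y) (x + y)) ≤
      ENNReal.ofReal (∑ k ∈ s, w k * (y / ((τ k - x) ^ 2 + y ^ 2))) :=
    (mul_le_mul_right (measure_mono hsub) _).trans (hmk.trans (ENNReal.ofReal_le_ofReal hle))
  have h2 := mul_le_mul_right h1 (ENNReal.ofReal (2 * y))
  rw [← mul_assoc, ← ENNReal.ofReal_mul (by positivity), ← ENNReal.ofReal_mul (by positivity),
    mul_one_div_cancel (by positivity), ENNReal.ofReal_one, one_mul] at h2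
  exact h2

/-- A measure whose mass on intervals is quadratically small vanishes. -/
theorem measure_Ico_eq_zero_of_quadratic {μ : Measure ℝ} {α β C : ℝ} (hαβ : α < β)
    (h : ∀ x ∈ Icc α β, ∀ y > 0, μ (Icc (x - y) (x + y)) ≤ ENNReal.ofReal (C * y ^ 2)) :
    μ (Ico α β) = 0 := by
  have key : ∀ n : ℕ, μ (Ico α β) ≤ ENNReal.ofReal (C * (β - α) ^ 2 * (1 / ((n : ℝ) + 1))) := by
    intro n
    set y : ℝ := (β - α) / (n + 1) with hy
    have hn : (0 : ℝ) < n + 1 := by positivity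
    have hy0 : 0 < y := div_pos (by linarith) hn
    have hyn : y * (n + 1) = β - α := div_mul_cancel₀ _ hn.ne'
    have hsub : Ico α β ⊆ ⋃ i ∈ Finset.range (n + 1), Icc (α + i * y - y) (α + i * y + y) := by
      rintro t ⟨h1, h2⟩
      have h3 : 0 ≤ (t - α) / y := div_nonneg (by linarith) hy0.le
      have h4 := Nat.floor_le h3
      have h5 := Nat.lt_floor_add_one ((t - α) / y)
      rw [le_div_iff₀ hy0] at h4
      rw [div_lt_iff₀ hy0] at h5
      refine mem_iUnion₂.2 ⟨⌊(t - α) / y⌋₊, ?_, by constructor <;> nlinarith⟩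
      rw [Finset.mem_range, Nat.floor_lt h3, div_lt_iff₀ hy0]
      push_cast
      linarith
    calc μ (Ico α β) ≤ ∑ i ∈ Finset.range (n + 1), μ (Icc (α + i * y - y) (α + i * y + y)) :=
          (measure_mono hsub).trans (measure_biUnion_finset_le _ _)
      _ ≤ ∑ i ∈ Finset.range (n + 1), ENNReal.ofReal (C * y ^ 2) := by
          refine Finset.sum_le_sum fun i hi => h _ ⟨?_, ?_⟩ y hy0
          · have : 0 ≤ (i : ℝ) * y := by positivity
            linarith
          · have : (i : ℝ) + 1 ≤ n + 1 := by exact_mod_cast Finset.mem_range.1 hi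
            nlinarith
      _ = _ := by
          rw [Finset.sum_const, Finset.card_range, nsmul_eq_mul, ← ENNReal.ofReal_natCast,
            ← ENNReal.ofReal_mul (by positivity)]
          congr 1
          push_cast
          rw [hy]
          field_simp
  have hlim : Filter.Tendsto (fun n : ℕ =>
      ENNReal.ofReal (C * (β - α) ^ 2 * (1 / ((n : ℝ) + 1)))) Filter.atTop (nhds 0) := by
    have := (tendsto_one_div_add_atTop_nhds_zero_nat (𝕜 := ℝ)).const_mul (C * (β - α) ^ 2)
    rw [mul_zero] at this
    simpa using ENNReal.tendsto_ofReal this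
  exact le_antisymm (ge_of_tendsto' hlim key) zero_le

/-- Away from the poles the Poisson sum is `O(y)`, so `measure_Icc_le` bounds the mass of short
intervals by `O(y^2)`. -/
theorem measure_compl_poles_eq_zero (hμ : Integrable (fun t : ℝ => 1 / (1 + t ^ 2)) μ)
    (ha : 0 ≤ a) (hw : ∀ k ∈ s, 0 ≤ w k)
    (hf : ∀ z : ℂ, 0 < z.im → ∑ k ∈ s, (w k : ℂ) / ((τ k : ℂ) - z) =
      a * z + b + ∫ t : ℝ, (1 / ((t : ℂ) - z) - (t : ℂ) / (1 + (t : ℂ) ^ 2)) ∂μ) :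
    μ ((s.image τ : Set ℝ)ᶜ) = 0 := by
  refine measure_null_of_locally_null _ fun x hx => ?_
  have hopen : IsOpen ((s.image τ : Set ℝ)ᶜ) := (Finset.finite_toSet _).isClosed.isOpen_compl
  obtain ⟨ε, hε, hball⟩ := Metric.isOpen_iff.1 hopen x hx
  refine ⟨Ico (x - ε / 2) (x + ε / 2),
    mem_nhdsWithin_of_mem_nhds (Ico_mem_nhds (by linarith) (by linarith)), ?_⟩
  have hs : 0 ≤ ∑ k ∈ s, w k := Finset.sum_nonneg hw
  refine measure_Ico_eq_zero_of_quadratic (C := 2 * (∑ k ∈ s, w k) / (ε / 2) ^ 2)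
    (by linarith) fun u hu y hy => ?_
  refine (measure_Icc_le hμ ha hf u hy).trans (ENNReal.ofReal_le_ofReal ?_)
  have hterm : ∑ k ∈ s, w k * (y / ((τ k - u) ^ 2 + y ^ 2)) ≤
      ∑ k ∈ s, w k * (y / (ε / 2) ^ 2) := by
    refine Finset.sum_le_sum fun k hk => mul_le_mul_of_nonneg_left ?_ (hw k hk)
    have hτ : ε ≤ |τ k - x| := by
      by_contra hcon
      exact hball (by simpa [Real.dist_eq] using hcon) (by simpa using ⟨k, hk, rfl⟩)
    have hu' : |u - x| ≤ ε / 2 := abs_le.2 ⟨by linarith [hu.1], by linarith [hu.2]⟩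
    have : ε / 2 ≤ |τ k - u| := by
      have := abs_sub_le (τ k) u x
      linarith
    have := pow_le_pow_left₀ (by linarith) this 2
    rw [sq_abs] at this
    gcongr
    nlinarith
  rw [← Finset.sum_mul] at hterm
  calc 2 * y * _ ≤ 2 * y * _ := mul_le_mul_of_nonneg_left hterm (by positivity)
    _ = _ := by ring

/-- The measure in the Herglotz representation of a finite sum of simple fractions. -/
theorem measure_eq_sum_dirac (hμ : Integrable (fun t : ℝ => 1 / (1 + t ^ 2)) μ)
    (ha : 0 ≤ a) (hw : ∀ k ∈ s, 0 ≤ w k) (hτ : InjOn τ s)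
    (hf : ∀ z : ℂ, 0 < z.im → ∑ k ∈ s, (w k : ℂ) / ((τ k : ℂ) - z) =
      a * z + b + ∫ t : ℝ, (1 / ((t : ℂ) - z) - (t : ℂ) / (1 + (t : ℂ) ^ 2)) ∂μ) :
    μ = ∑ k ∈ s, ENNReal.ofReal (w k) • Measure.dirac (τ k) := by
  classical
  have hnull := measure_compl_poles_eq_zero hμ ha hw hf
  have hdirac : μ = ∑ k ∈ s, μ {τ k} • Measure.dirac (τ k) := by
    ext A hA
    have h1 : μ A = μ ((s.filter fun k => τ k ∈ A).image τ : Finset ℝ) := by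
      rw [← measure_inter_add_sdiff A (Finset.finite_toSet (s.image τ)).measurableSet,
        measure_mono_null (show A \ (s.image τ : Set ℝ) ⊆ _ from fun x hx => hx.2) hnull, add_zero]
      congr 1
      ext x
      simp only [mem_inter_iff, Finset.coe_image, mem_image, Finset.mem_coe, Finset.mem_filter]
      constructor
      · rintro ⟨hx, k, hk, rfl⟩; exact ⟨k, ⟨hk, hx⟩, rfl⟩
      · rintro ⟨k, ⟨hk, hx⟩, rfl⟩; exact ⟨hx, k, hk, rfl⟩
    rw [h1, ← sum_measure_singleton,
      Finset.sum_image (hτ.mono (Finset.coe_subset.2 (Finset.filter_subset _ _))), Finset.sum_filter,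
      Measure.finsetSum_apply]
    refine Finset.sum_congr rfl fun k _ => ?_
    rw [Measure.smul_apply, Measure.dirac_apply' _ hA]
    by_cases hk : τ k ∈ A <;> simp [hk]
  have hfin : ∀ x : ℝ, μ {x} ≠ ⊤ := fun x => by
    have := measure_Icc_le hμ ha hf x one_pos
    refine ((measure_mono (singleton_subset_iff.2 ?_)).trans_lt
      (this.trans_lt ENNReal.ofReal_lt_top)).ne
    constructor <;> linarith
  -- Multiply the Poisson identity at `x = τ j` by `y` and let `y → 0+`: only the atom at `τ j`
  -- survives on either side, and `a * y^2` vanishes.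
  have hweight : ∀ j ∈ s, (μ {τ j}).toReal = w j := by
    intro j hj
    have hint : ∀ x : ℝ, ∀ y > 0, ∫ t, y / ((t - x) ^ 2 + y ^ 2) ∂μ =
        ∑ k ∈ s, (μ {τ k}).toReal * (y / ((τ k - x) ^ 2 + y ^ 2)) := by
      intro x y hy
      conv_lhs => rw [hdirac]
      rw [integral_finsetSum_measure]
      · refine Finset.sum_congr rfl fun k _ => ?_
        rw [integral_smul_measure, integral_dirac, smul_eq_mul]
      · intro k _
        exact (integrable_dirac (by finiteness)).smul_measure (hfin _)
    have hterm : ∀ c : ι → ℝ, Filter.Tendsto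
        (fun y : ℝ => ∑ k ∈ s, c k * (y ^ 2 / ((τ k - τ j) ^ 2 + y ^ 2)))
        (nhdsWithin 0 (Ioi 0)) (nhds (c j)) := by
      intro c
      have : c j = ∑ k ∈ s, c k * (if k = j then 1 else 0) := by simp [hj]
      rw [this]
      refine tendsto_finsetSum _ fun k hk => Filter.Tendsto.const_mul _ ?_
      split_ifs with hkj
      · subst hkj
        refine tendsto_const_nhds.congr' ?_
        filter_upwards [self_mem_nhdsWithin] with y hy
        have : y ≠ 0 := ne_of_gt hy
        simp [this]
      · have hne : (τ k - τ j) ^ 2 ≠ 0 := pow_ne_zero 2 (sub_ne_zero.2 fun h => hkj (hτ hk hj h))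
        have hc : ContinuousAt (fun y : ℝ => y ^ 2 / ((τ k - τ j) ^ 2 + y ^ 2)) 0 :=
          ContinuousAt.div (by fun_prop) (by fun_prop) (by simpa using hne)
        have := hc.tendsto
        simp only [ne_eq, OfNat.ofNat_ne_zero, not_false_eq_true, zero_pow, zero_div] at this
        exact this.mono_left nhdsWithin_le_nhds
    have h1 := hterm w
    have h2 : Filter.Tendsto (fun y : ℝ => a * y ^ 2) (nhdsWithin 0 (Ioi 0)) (nhds 0) := by
      have : Continuous fun y : ℝ => a * y ^ 2 := by fun_prop
      have := this.tendsto 0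
      simp only [ne_eq, OfNat.ofNat_ne_zero, not_false_eq_true, zero_pow, mul_zero] at this
      exact this.mono_left nhdsWithin_le_nhds
    have h3 := h2.add (hterm fun k => (μ {τ k}).toReal)
    rw [zero_add] at h3
    refine tendsto_nhds_unique h3 (h1.congr' ?_)
    filter_upwards [self_mem_nhdsWithin] with y hy
    symm
    have h4 := poisson_eq hμ hf (τ j) hy
    rw [hint _ y hy] at h4
    have h5 := congrArg (y * ·) h4
    simp only [mul_add, Finset.mul_sum] at h5
    calc a * y ^ 2 + ∑ k ∈ s, (μ {τ k}).toReal * (y ^ 2 / ((τ k - τ j) ^ 2 + y ^ 2))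
        = y * (a * y) +
            ∑ k ∈ s, y * ((μ {τ k}).toReal * (y / ((τ k - τ j) ^ 2 + y ^ 2))) := by
          congr 1
          · ring
          · exact Finset.sum_congr rfl fun k _ => by ring
      _ = ∑ k ∈ s, y * (w k * (y / ((τ k - τ j) ^ 2 + y ^ 2))) := h5.symm
      _ = _ := Finset.sum_congr rfl fun k _ => by ring
  rw [hdirac]
  refine Finset.sum_congr rfl fun k hk => ?_
  rw [← hweight k hk, ENNReal.ofReal_toReal (hfin _)]

end

/-! ### Chains of indivisible intervals -/

theorem inner_eq (u v : EuclideanSpace ℝ (Fin 2)) : inner ℝ u v = u 0 * v 0 + u 1 * v 1 := by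
  rw [PiLp.inner_apply, Fin.sum_univ_two]
  simp [mul_comm]

theorem inner_perp_eq (u v : EuclideanSpace ℝ (Fin 2)) :
    inner ℝ (perp u) v = -(u 1 * v 0 - u 0 * v 1) := by
  rw [inner_eq]
  simp [perp]
  ring

theorem chainDelta_eq (e : ℕ → EuclideanSpace ℝ (Fin 2)) (k : ℕ) :
    chainDelta e k = e k 1 * e (k + 1) 0 - e k 0 * e (k + 1) 1 := by
  rw [chainDelta, inner_perp_eq, neg_neg]

theorem cot_eq (e : ℕ → EuclideanSpace ℝ (Fin 2)) (k : ℕ) :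
    cot (e k) (e (k + 1)) = -(inner ℝ (e k) (e (k + 1)) / chainDelta e k) := by
  rw [cot, chainDelta, div_neg, neg_neg]

namespace IsIndivisibleChain

variable {H : ℝ → Matrix (Fin 2) (Fin 2) ℝ} {L : ℝ} {K : ℕ} {l : ℕ → ℝ}
  {e : ℕ → EuclideanSpace ℝ (Fin 2)}

theorem length_pos (h : IsIndivisibleChain H L K l e) {k : ℕ} (hk : 1 ≤ k) (hkK : k ≤ K) :
    0 < l k := by
  have := (h.indivisible k (Finset.mem_Icc.2 ⟨hk, hkK⟩)).lt
  obtain ⟨k, rfl⟩ : ∃ n, k = n + 1 := ⟨k - 1, by omega⟩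
  rw [Finset.sum_Icc_succ_top (by omega), Nat.add_sub_cancel] at this
  linarith

/-- The trace of `e eᵀ` is the squared norm of `e`; trace one holds almost everywhere on an interval
of positive length. -/
theorem direction_unit (h : IsIndivisibleChain H L K l e) {k : ℕ} (hk : 1 ≤ k) (hkK : k ≤ K) :
    e k 0 ^ 2 + e k 1 ^ 2 = 1 := by
  have hi := h.indivisible k (Finset.mem_Icc.2 ⟨hk, hkK⟩)
  have hd := hi.direction
  have ht := ae_restrict_of_ae_restrict_of_subset (Ioo_subset_Ioo hi.nonneg hi.le)
    h.hamiltonian.trace_eq_one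
  have hne : (ae (volume.restrict (Ioo (∑ j ∈ Finset.Icc 1 (k - 1), l j)
      (∑ j ∈ Finset.Icc 1 k, l j)))).NeBot := by
    rw [ae_neBot, Ne, Measure.restrict_eq_zero, Real.volume_Ioo]
    have := hi.lt
    simpa using this
  obtain ⟨x, hx, hx'⟩ := (hd.and ht).exists
  rw [hx, Matrix.trace_fin_two, Matrix.vecMulVec_apply, Matrix.vecMulVec_apply] at hx'
  linarith

end IsIndivisibleChain

/-! ### Directions close to the horizontal axis -/

/-- Directions `(E n, F n)`, `1 ≤ n ≤ N + 1`, each of which is, up to sign, a small rotation of its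
predecessor, with sines `δ n` and cosines `c n`. -/
structure IsDirectionChain (N : ℕ) (E F c δ : ℕ → ℝ) : Prop where
  unit : ∀ n, 1 ≤ n → n ≤ N + 1 → E n ^ 2 + F n ^ 2 = 1
  first : F 1 = 0
  cos_eq : ∀ n, c n = E n * E (n + 1) + F n * F (n + 1)
  sin_eq : ∀ n, δ n = F n * E (n + 1) - E n * F (n + 1)
  cos_neg : ∀ n, 1 ≤ n → n ≤ N → c n < 0
  sin_pos : ∀ n, 1 ≤ n → n ≤ N → 0 < δ n
  sin_le : δ 1 ≤ 1 / 1000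
  sin_succ_le : ∀ n, 1 ≤ n → n + 1 ≤ N → 2 * δ (n + 1) ≤ δ n

namespace IsDirectionChain

variable {N : ℕ} {E F c δ : ℕ → ℝ}

/-- Expansion of the next direction in the orthonormal basis of the current direction and its
perpendicular. -/
theorem E_succ (h : IsDirectionChain N E F c δ) {n : ℕ} (hn : 1 ≤ n) (hnN : n ≤ N + 1) :
    E (n + 1) = c n * E n + δ n * F n := by
  rw [h.cos_eq, h.sin_eq]
  linear_combination -E (n + 1) * h.unit n hn hnN

theorem F_succ (h : IsDirectionChain N E F c δ) {n : ℕ} (hn : 1 ≤ n) (hnN : n ≤ N + 1) :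
    F (n + 1) = c n * F n - δ n * E n := by
  rw [h.cos_eq, h.sin_eq]
  linear_combination -F (n + 1) * h.unit n hn hnN

theorem E_pred (h : IsDirectionChain N E F c δ) {n : ℕ} (hnN : n ≤ N) :
    E n = c n * E (n + 1) - δ n * F (n + 1) := by
  rw [h.cos_eq, h.sin_eq]
  linear_combination -E n * h.unit (n + 1) (by omega) (by omega)

theorem cos_sq_add_sin_sq (h : IsDirectionChain N E F c δ) {n : ℕ} (hn : 1 ≤ n) (hnN : n ≤ N) :
    c n ^ 2 + δ n ^ 2 = 1 := by
  have h1 := h.unit n hn (by omega)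
  have h2 := h.unit (n + 1) (by omega) (by omega)
  have : c n ^ 2 + δ n ^ 2 = (E n ^ 2 + F n ^ 2) * (E (n + 1) ^ 2 + F (n + 1) ^ 2) := by
    rw [h.cos_eq, h.sin_eq]; ring
  rw [this, h1, h2, one_mul]

theorem sin_le_of_le (h : IsDirectionChain N E F c δ) {n : ℕ} (hn : 1 ≤ n) (hnN : n ≤ N) :
    δ n ≤ 1 / 1000 := by
  induction n, hn using Nat.le_induction with
  | base => exact h.sin_le
  | succ n hn ih =>
    have := ih (by omega)
    have := h.sin_succ_le n hn hnN
    have := h.sin_pos (n + 1) (by omega) hnN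
    linarith

theorem abs_F_succ_le (h : IsDirectionChain N E F c δ) {n : ℕ} (hn : 1 ≤ n) (hnN : n ≤ N) :
    |F (n + 1)| ≤ |F n| + δ n := by
  have h1 := h.unit n hn (by omega)
  have h2 := h.cos_sq_add_sin_sq hn hnN
  have h3 := h.sin_pos n hn hnN
  rw [h.F_succ hn (by omega)]
  refine (abs_sub _ _).trans ?_
  rw [abs_mul, abs_mul, abs_of_pos h3]
  have hc : |c n| ≤ 1 := by rw [← sq_le_one_iff_abs_le_one]; nlinarith
  have hE : |E n| ≤ 1 := by rw [← sq_le_one_iff_abs_le_one]; nlinarith [sq_nonneg (F n)]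
  have := mul_le_mul_of_nonneg_right hc (abs_nonneg (F n))
  have := mul_le_mul_of_nonneg_left hE h3.le
  linarith

/-- The increments `δ n` at least halve each time; `-2 * δ n` is the remainder of the geometric
series that makes the induction close. -/
theorem abs_F_le (h : IsDirectionChain N E F c δ) {n : ℕ} (hn : 1 ≤ n) (hnN : n ≤ N) :
    |F n| ≤ 2 * δ 1 - 2 * δ n := by
  induction n, hn using Nat.le_induction with
  | base => simp [h.first]
  | succ n hn ih =>
    have := ih (by omega)
    have := h.abs_F_succ_le hn (by omega)
    have := h.sin_succ_le n hn hnN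
    linarith

theorem abs_F_le_const (h : IsDirectionChain N E F c δ) {n : ℕ} (hn : 1 ≤ n) (hnN : n ≤ N + 1) :
    |F n| ≤ 1 / 500 := by
  have h1 := h.sin_le
  rcases Nat.lt_or_ge N n with h2 | h2
  · obtain rfl : n = N + 1 := by omega
    rcases Nat.eq_zero_or_pos N with rfl | hN
    · rw [h.first]; norm_num
    · have := h.abs_F_le hN le_rfl
      have := h.abs_F_succ_le hN le_rfl
      have := h.sin_pos N hN le_rfl
      linarith
  · have := h.abs_F_le hn h2
    have := h.sin_pos n hn h2
    linarith

theorem E_sq_ge (h : IsDirectionChain N E F c δ) {n : ℕ} (hn : 1 ≤ n) (hnN : n ≤ N + 1) :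
    0.9999 ≤ E n ^ 2 := by
  have h1 := h.unit n hn hnN
  have h2 := pow_le_pow_left₀ (abs_nonneg _) (h.abs_F_le_const hn hnN) 2
  rw [sq_abs] at h2
  linarith

theorem E_sq_le (h : IsDirectionChain N E F c δ) {n : ℕ} (hn : 1 ≤ n) (hnN : n ≤ N + 1) :
    E n ^ 2 ≤ 1 := by
  have h1 := h.unit n hn hnN
  nlinarith [sq_nonneg (F n)]

theorem E_ne_zero (h : IsDirectionChain N E F c δ) {n : ℕ} (hn : 1 ≤ n) (hnN : n ≤ N + 1) :
    E n ≠ 0 := by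
  intro h0
  have := h.E_sq_ge hn hnN
  rw [h0] at this
  norm_num at this

/-- The cosine is negative and nearly `-1`, so consecutive `E` alternate in sign. This makes the
gaps of the string positive and close to `δ n`. -/
theorem neg_E_mul_ge (h : IsDirectionChain N E F c δ) {n : ℕ} (hn : 1 ≤ n) (hnN : n ≤ N) :
    0.9995 ≤ -(E n * E (n + 1)) := by
  have h1 := h.E_sq_ge hn (by omega)
  have h2 := h.cos_sq_add_sin_sq hn hnN
  have h3 := h.sin_le_of_le hn hnN
  have h4 := h.sin_pos n hn hnN
  have h5 := h.cos_neg n hn hnN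
  have h6 : |E n * F n| ≤ 1 / 500 := by
    rw [abs_mul]
    have hE : |E n| ≤ 1 := by
      rw [← sq_le_one_iff_abs_le_one]; exact h.E_sq_le hn (by omega)
    have := h.abs_F_le_const hn (by omega)
    nlinarith [abs_nonneg (F n)]
  have h7 : c n ≤ -0.9999 := by nlinarith
  have h8 : E n * E (n + 1) = c n * E n ^ 2 + δ n * (E n * F n) := by
    rw [h.E_succ hn (by omega)]; ring
  have h9 := (abs_le.1 h6).2
  rw [h8]
  nlinarith

theorem neg_E_mul_le (h : IsDirectionChain N E F c δ) {n : ℕ} (hn : 1 ≤ n) (hnN : n ≤ N) :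
    -(E n * E (n + 1)) ≤ 1 := by
  have h1 := h.E_sq_le hn (by omega)
  have h2 := h.E_sq_le (n := n + 1) (by omega) (by omega)
  nlinarith [sq_nonneg (E n + E (n + 1))]

/-- The gaps of the string of a chain of directions. -/
theorem gap_bounds (h : IsDirectionChain N E F c δ) {n : ℕ} (hn : 1 ≤ n) (hnN : n ≤ N) :
    δ n ≤ δ n / -(E n * E (n + 1)) ∧ δ n / -(E n * E (n + 1)) ≤ 1.001 * δ n := by
  have h1 := h.neg_E_mul_ge hn hnN
  have h2 := h.neg_E_mul_le hn hnN
  have h3 := h.sin_pos n hn hnN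
  rw [le_div_iff₀ (by linarith), div_le_iff₀ (by linarith)]
  constructor <;> nlinarith

end IsDirectionChain

/-! ### From the Jacobi matrix to the string -/

/-- The contribution of the right neighbour to a Jacobi row, together with its share of the
diagonal. Adding `three_term_left` cancels `F₁ * w₁` and leaves the jump of the slope divided by
`E₁`. -/
theorem three_term_right {E₁ E₂ F₁ c δ w₁ w₂ b₂ : ℝ} (hE₁ : E₁ ≠ 0) (hE₂ : E₂ ≠ 0) (hδ : δ ≠ 0)
    (hE : E₂ = c * E₁ + δ * F₁) (hw : w₂ = w₁ + δ / -(E₁ * E₂) * b₂) :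
    (E₂ * w₂ - c * E₁ * w₁) / δ = F₁ * w₁ - b₂ / E₁ := by
  have h1 : E₂ * w₂ = E₂ * w₁ - δ * b₂ / E₁ := by
    rw [hw]; field_simp; ring
  rw [h1]
  conv_lhs => rw [hE]
  field_simp
  ring

theorem three_term_left {E₀ E₁ F₁ c δ w₀ w₁ b₁ : ℝ} (hE₀ : E₀ ≠ 0) (hE₁ : E₁ ≠ 0) (hδ : δ ≠ 0)
    (hE : E₀ = c * E₁ - δ * F₁) (hw : w₁ = w₀ + δ / -(E₀ * E₁) * b₁) :
    (E₀ * w₀ - c * E₁ * w₁) / δ = -F₁ * w₁ + b₁ / E₁ := by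
  have h1 : E₀ * w₀ = E₀ * w₁ + δ * b₁ / E₁ := by
    rw [hw]; field_simp; ring
  rw [h1]
  conv_lhs => rw [hE]
  field_simp
  ring

/-- The mass that corresponds to the `n`-th interval of a chain (counted from zero). -/
def stringMass (l : ℕ → ℝ) (e : ℕ → EuclideanSpace ℝ (Fin 2)) (n : ℕ) : ℝ :=
  l (n + 1) * e (n + 1) 0 ^ 2

/-- The gap that corresponds to the `n`-th interval of a chain (counted from zero). -/
def stringGap (e : ℕ → EuclideanSpace ℝ (Fin 2)) (n : ℕ) : ℝ :=
  chainDelta e (n + 1) / -(e (n + 1) 0 * e (n + 2) 0)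

/-- The sequence that restricts to an eigenvector of the Jacobi matrix of a chain, when `z` is an
eigenvalue. -/
def chainVector (l : ℕ → ℝ) (e : ℕ → EuclideanSpace ℝ (Fin 2)) (z : ℝ) (n : ℕ) : ℝ :=
  Real.sqrt (l (n + 1)) * (e (n + 1) 0 * amp (stringMass l e) (stringGap e) z n)

section

variable {N : ℕ} {l : ℕ → ℝ} {e : ℕ → EuclideanSpace ℝ (Fin 2)}

/-- The chain of directions of a chain of indivisible intervals. -/
abbrev IsChainOfDirections (N : ℕ) (e : ℕ → EuclideanSpace ℝ (Fin 2)) : Prop :=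
  IsDirectionChain N (fun n => e n 0) (fun n => e n 1) (fun n => inner ℝ (e n) (e (n + 1)))
    (chainDelta e)

theorem chainOffDiag_eq (n : ℕ) (hl : 0 ≤ l (n + 1)) :
    chainOffDiag l e n =
      1 / (Real.sqrt (l (n + 1)) * Real.sqrt (l n) * chainDelta e n) := by
  rw [chainOffDiag, Real.sqrt_mul hl, chainDelta]
  rw [mul_neg, div_neg]

theorem chainJacobi_mulVec (hl : ∀ n, 1 ≤ n → n ≤ N + 1 → 0 < l n)
    (he : IsChainOfDirections N e) {z : ℝ}
    (hz : amp (stringMass l e) (stringGap e) z N = 0) :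
    (chainJacobi N l e).mulVec (fun i => chainVector l e z i) =
      z • fun i : Fin N => chainVector l e z i := by
  ext i
  have hu : chainVector l e z N = 0 := by rw [chainVector, hz]; simp
  rw [chainJacobi, jacobiMatrix_mulVec _ _ _ hu, Pi.smul_apply, smul_eq_mul]
  obtain ⟨n, hn⟩ := i
  simp only
  have hl1 := hl (n + 1) (by omega) (by omega)
  have hl2 := hl (n + 2) (by omega) (by omega)
  have hδ := (he.sin_pos (n + 1) (by omega) (by omega)).ne'
  have hE1 := he.E_ne_zero (n := n + 1) (by omega) (by omega)
  have hE2 := he.E_ne_zero (n := n + 2) (by omega) (by omega)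
  have hright := three_term_right hE1 hE2 hδ (he.E_succ (by omega) (by omega))
    (amp_succ (stringMass l e) (stringGap e) z n)
  have hb := slope_succ (stringMass l e) (stringGap e) z n
  have hs1 : Real.sqrt (l (n + 1)) ^ 2 = l (n + 1) := Real.sq_sqrt hl1.le
  have hs1' := (Real.sqrt_pos.2 hl1).ne'
  have hs2' := (Real.sqrt_pos.2 hl2).ne'
  rw [chainOffDiag_eq (n + 1) hl2.le]
  set s := Real.sqrt (l (n + 1)) with hs
  set w := amp (stringMass l e) (stringGap e) z n with hw
  have hmass : slope (stringMass l e) (stringGap e) z (n + 1) / e (n + 1) 0 =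
      slope (stringMass l e) (stringGap e) z n / e (n + 1) 0 - z * s ^ 2 * e (n + 1) 0 * w := by
    rw [hb, hs1, stringMass]
    field_simp
  have hr : 1 / (Real.sqrt (l (n + 1 + 1)) * s * chainDelta e (n + 1)) *
      chainVector l e z (n + 1) = (e (n + 2) 0 * amp (stringMass l e) (stringGap e) z (n + 1) /
        chainDelta e (n + 1)) / s := by
    rw [chainVector]
    field_simp
  have hv : chainVector l e z n = s * (e (n + 1) 0 * w) := rfl
  rw [hr, hv]
  -- The first row has no left neighbour; the horizontal first direction and the free left end
  -- (slope zero) replace it.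
  cases n with
  | zero =>
    have hF : e 1 1 = 0 := he.first
    rw [chainDiag, if_pos rfl, cot_eq, if_pos rfl, hF]
    simp only [zero_add] at hright hmass hδ hE1 hE2 ⊢
    rw [slope_zero] at hmass
    have h3 : e 2 0 * amp (stringMass l e) (stringGap e) z 1 / chainDelta e 1 =
      inner ℝ (e 1) (e 2) * e 1 0 * w / chainDelta e 1 + z * s ^ 2 * e 1 0 * w := by
      rw [sub_div] at hright
      linear_combination hright - hmass + w * hF
    rw [h3, ← hs1]
    field_simp
    ring
  | succ n =>
    have hl0 := hl (n + 1) (by omega) (by omega)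
    have hs0' := (Real.sqrt_pos.2 hl0).ne'
    have hδ0 := (he.sin_pos (n + 1) (by omega) (by omega)).ne'
    have hE0 := he.E_ne_zero (n := n + 1) (by omega) (by omega)
    have hleft := three_term_left hE0 hE1 hδ0 (he.E_pred (by omega))
      (amp_succ (stringMass l e) (stringGap e) z n)
    rw [if_neg (by omega), chainDiag, if_neg (by omega), cot_eq,
      chainOffDiag_eq (n + 1) hl1.le, Nat.add_sub_cancel, Nat.add_sub_cancel, cot_eq]
    have hr0 : 1 / (s * Real.sqrt (l (n + 1)) * chainDelta e (n + 1)) * chainVector l e z n =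
        (e (n + 1) 0 * amp (stringMass l e) (stringGap e) z n / chainDelta e (n + 1)) / s := by
      rw [chainVector]
      field_simp
    rw [hr0]
    rw [sub_div] at hright hleft
    rw [← hs1]
    have h3 : -(inner ℝ (e (n + 1 + 1)) (e (n + 1 + 1 + 1)) * e (n + 1 + 1) 0 * w /
          chainDelta e (n + 1 + 1))
        - inner ℝ (e (n + 1)) (e (n + 1 + 1)) * e (n + 1 + 1) 0 * w / chainDelta e (n + 1)
        + e (n + 1 + 2) 0 * amp (stringMass l e) (stringGap e) z (n + 1 + 1) /
          chainDelta e (n + 1 + 1)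
        + e (n + 1) 0 * amp (stringMass l e) (stringGap e) z n / chainDelta e (n + 1) =
        z * s ^ 2 * e (n + 1 + 1) 0 * w := by
      linear_combination hright + hleft - hmass
    have h4 := congrArg (· / s) h3
    refine Eq.trans ?_ (h4.trans ?_)
    · simp only
      field_simp
      ring
    · simp only
      field_simp

theorem chainVector_sq (hl : ∀ n, 1 ≤ n → n ≤ N + 1 → 0 < l n) {z : ℝ} {n : ℕ} (hn : n < N) :
    chainVector l e z n * chainVector l e z n =
      stringMass l e n * amp (stringMass l e) (stringGap e) z n ^ 2 := by
  have := Real.mul_self_sqrt (hl (n + 1) (by omega) (by omega)).le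
  rw [chainVector, stringMass]
  linear_combination (e (n + 1) 0 * amp (stringMass l e) (stringGap e) z n) ^ 2 * this

end

/-- Comparison of consecutive eigenvalues and masses. -/
theorem lacunary_step {lam ϰ θ l₁ M g M' g' t t' S S' : ℝ} (hϰ : 0 < ϰ)
    (hθ : 0 < θ) (hl : 0 < l₁) (hM : 0 < M) (hg : 0 < g) (hM' : 0 < M') (hg' : 0 < g')
    (ht : 1 / 2 ≤ t * (M * g)) (ht2 : t * (M * g) ≤ 2)
    (ht' : 1 / 2 ≤ t' * (M' * g')) (ht2' : t' * (M' * g') ≤ 2)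
    (hS : 0.9 * M ≤ S) (hS2 : S ≤ 2.1 * M) (hS' : 0.9 * M' ≤ S') (hS2' : S' ≤ 2.1 * M')
    (h1 : 99 * ϰ * g' ≤ g) (h2 : 99 * lam * (M * g) ≤ M' * g')
    (h3 : 99 * (M * g ^ 2) ≤ θ * (M' * g' ^ 2)) :
    t > lam * t' ∧ l₁ / S / t > ϰ * (l₁ / S' / t') ∧
      l₁ / S / t ^ 2 < θ * (l₁ / S' / t' ^ 2) := by
  have ha : 0 < M * g := by positivity
  have ha' : 0 < M' * g' := by positivity
  have htp : 0 < t := by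
    by_contra hcon
    nlinarith
  have htp' : 0 < t' := by
    by_contra hcon
    nlinarith
  have hSp : 0 < S := by linarith
  have hSp' : 0 < S' := by linarith
  refine ⟨?_, ?_, ?_⟩
  · have f1 := mul_le_mul_of_nonneg_left h2 htp'.le
    have f2 : M * g * (lam * t') < M * g * t := by nlinarith
    exact lt_of_mul_lt_mul_left f2 ha.le
  -- Since `S ≈ M` and `t ≈ 1 / (M * g)`, the products `S * t * g` and `S' * t' * g'` lie between
  -- `0.45` and `4.2`; the factor 99 exceeds their ratio. The third claim uses `S * t^2 * M * g^2`
  -- likewise, with `0.225` and `8.4`.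
  · have f1 : S * t * g ≤ 4.2 := by
      have := mul_le_mul_of_nonneg_right hS2 (mul_pos htp hg).le
      nlinarith
    have f2 : 0.45 ≤ S' * t' * g' := by
      have := mul_le_mul_of_nonneg_right hS' (mul_pos htp' hg').le
      nlinarith
    have f3 : ϰ * (S * t) * (g * g') < S' * t' * (g * g') := by
      have e1 := mul_le_mul_of_nonneg_right f1 (mul_pos hϰ hg').le
      have e2 := mul_le_mul_of_nonneg_right f2 hg.le
      have e3 : 0 < ϰ * g' := mul_pos hϰ hg'
      linarith
    have f4 := lt_of_mul_lt_mul_right f3 (by positivity)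
    have f5 := mul_lt_mul_of_pos_left f4 hl
    rw [div_div, div_div, gt_iff_lt, ← mul_div_assoc,
      div_lt_div_iff₀ (by positivity) (by positivity)]
    linarith
  · have f1 : 0.225 ≤ S * t ^ 2 * (M * g ^ 2) := by
      have e1 : S * t ^ 2 * (M * g ^ 2) * M = S * (t * (M * g)) ^ 2 := by ring
      have e2 : 1 / 4 ≤ (t * (M * g)) ^ 2 := by nlinarith
      have e3 : M * 0.225 ≤ M * (S * t ^ 2 * (M * g ^ 2)) := by
        rw [mul_comm M (S * t ^ 2 * _), e1]
        nlinarith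
      exact le_of_mul_le_mul_left e3 hM
    have f2 : S' * t' ^ 2 * (M' * g' ^ 2) ≤ 8.4 := by
      have e1 : S' * t' ^ 2 * (M' * g' ^ 2) * M' = S' * (t' * (M' * g')) ^ 2 := by ring
      have e2 : (t' * (M' * g')) ^ 2 ≤ 4 := by nlinarith
      have e3 : M' * (S' * t' ^ 2 * (M' * g' ^ 2)) ≤ M' * 8.4 := by
        rw [mul_comm M' (S' * t' ^ 2 * _), e1]
        nlinarith
      exact le_of_mul_le_mul_left e3 hM'
    set A := M * g ^ 2 with hA
    set A' := M' * g' ^ 2 with hA'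
    have hAp : 0 < A := by positivity
    have hAp' : 0 < A' := by positivity
    have f3 : S' * t' ^ 2 * (A * A') < θ * (S * t ^ 2) * (A * A') := by
      have e1 := mul_le_mul_of_nonneg_right f2 hAp.le
      have e2 := mul_le_mul_of_nonneg_right f1 (mul_pos hθ hAp').le
      linarith
    have f4 := lt_of_mul_lt_mul_right f3 (by positivity)
    have f5 := mul_lt_mul_of_pos_left f4 hl
    rw [div_div, div_div, ← mul_div_assoc, div_lt_div_iff₀ (by positivity) (by positivity)]
    linarith

end LacunaryJacobi

end

/-! ### The main theorem -/

open LacunaryJacobi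

theorem theorem5 (N : ℕ) [NeZero N] (lam ϰ θ : ℝ)
    (hlam : 1000 < lam) (hϰ : 100 < ϰ) (hθ : 10 / lam < θ) (hθ' : θ < 1 / 100)
    (L : ℝ) (H : ℝ → Matrix (Fin 2) (Fin 2) ℝ)
    (l : ℕ → ℝ) (e : ℕ → EuclideanSpace ℝ (Fin 2))
    (hH : LacunaryJacobi.IsIndivisibleChain H L (N + 1) l e)
    (he1 : e 1 = !₂[1, 0])
    (hsign : ∀ n : ℕ, 1 ≤ n → n ≤ N → inner ℝ (e n) (e (n + 1)) < 0)
    (hδ1 : 1 / 1001 < LacunaryJacobi.chainDelta e 1)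
    (hδ1' : LacunaryJacobi.chainDelta e 1 < 1 / 1000)
    (h1 : ∀ n : ℕ, 1 ≤ n → n + 1 ≤ N →
      LacunaryJacobi.chainDelta e n / LacunaryJacobi.chainDelta e (n + 1) > 100 * ϰ)
    (h2 : ∀ n : ℕ, 1 ≤ n → n + 1 ≤ N →
      (l (n + 1) * LacunaryJacobi.chainDelta e (n + 1)) /
        (l n * LacunaryJacobi.chainDelta e n) > 100 * lam)
    (h3 : ∀ n : ℕ, 1 ≤ n → n + 1 ≤ N →
      (l (n + 1) * LacunaryJacobi.chainDelta e (n + 1) ^ 2) /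
        (l n * LacunaryJacobi.chainDelta e n ^ 2) > 100 * θ⁻¹)
    (μ : MeasureTheory.Measure ℝ)
    (hμ : LacunaryJacobi.IsSpectralData (LacunaryJacobi.chainJacobi N l e) μ) :
    LacunaryJacobi.IsCompletelyLacunary lam ϰ θ N μ := by
  have hN : 0 < N := Nat.pos_of_ne_zero (NeZero.ne N)
  have hθ0 : 0 < θ := lt_trans (by positivity) hθ
  have hl : ∀ n, 1 ≤ n → n ≤ N + 1 → 0 < l n := fun n hn hnN => hH.length_pos hn hnN
  have hδ : ∀ n, 1 ≤ n → n ≤ N → 0 < chainDelta e n := by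
    intro n hn
    induction n, hn using Nat.le_induction with
    | base => intro _; linarith
    | succ n hn ih =>
      intro hnN
      have hq := h1 n hn hnN
      by_contra hcon
      have := div_nonpos_of_nonneg_of_nonpos (ih (by omega)).le (not_lt.1 hcon)
      linarith
  have h1' : ∀ n, 1 ≤ n → n + 1 ≤ N →
      100 * ϰ * chainDelta e (n + 1) ≤ chainDelta e n := fun n hn hnN =>
    ((lt_div_iff₀ (hδ _ (by omega) hnN)).1 (h1 n hn hnN)).le
  have h2' : ∀ n, 1 ≤ n → n + 1 ≤ N →
      100 * lam * (l n * chainDelta e n) ≤ l (n + 1) * chainDelta e (n + 1) := fun n hn hnN =>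
    ((lt_div_iff₀ (mul_pos (hl n hn (by omega)) (hδ n hn (by omega)))).1 (h2 n hn hnN)).le
  have h3' : ∀ n, 1 ≤ n → n + 1 ≤ N →
      100 * (l n * chainDelta e n ^ 2) ≤ θ * (l (n + 1) * chainDelta e (n + 1) ^ 2) := by
    intro n hn hnN
    have h4 := ((lt_div_iff₀ (mul_pos (hl n hn (by omega))
      (pow_pos (hδ n hn (by omega)) 2))).1 (h3 n hn hnN)).le
    have h5 := mul_le_mul_of_nonneg_left h4 hθ0.le
    calc _ = θ * (100 * θ⁻¹ * (l n * chainDelta e n ^ 2)) := by field_simp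
      _ ≤ _ := h5
  have hdir : IsChainOfDirections N e :=
    { unit := fun n hn hnN => hH.direction_unit hn hnN
      first := by rw [he1]; simp
      cos_eq := fun n => inner_eq _ _
      sin_eq := fun n => chainDelta_eq e n
      cos_neg := hsign
      sin_pos := hδ
      sin_le := hδ1'.le
      sin_succ_le := fun n hn hnN => by
        have := h1' n hn hnN
        have := hδ (n + 1) (by omega) hnN
        nlinarith }
  set M := stringMass l e with hM
  set g := stringGap e with hg
  have hgl : ∀ n < N, chainDelta e (n + 1) ≤ g n := fun n hn =>
    (hdir.gap_bounds (by omega) (by omega)).1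
  have hgu : ∀ n < N, g n ≤ 1.001 * chainDelta e (n + 1) := fun n hn =>
    (hdir.gap_bounds (by omega) (by omega)).2
  have hMl : ∀ n < N, 0.9999 * l (n + 1) ≤ M n := fun n hn => by
    have := hdir.E_sq_ge (n := n + 1) (by omega) (by omega)
    have := hl (n + 1) (by omega) (by omega)
    rw [hM, stringMass]
    nlinarith
  have hMu : ∀ n < N, M n ≤ l (n + 1) := fun n hn => by
    have := hdir.E_sq_le (n := n + 1) (by omega) (by omega)
    have := hl (n + 1) (by omega) (by omega)
    rw [hM, stringMass]
    nlinarith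
  have hMp : ∀ n < N, 0 < M n := fun n hn => by
    have := hMl n hn
    have := hl (n + 1) (by omega) (by omega)
    linarith
  have hgp : ∀ n < N, 0 < g n := fun n hn => (hδ (n + 1) (by omega) (by omega)).trans_le (hgl n hn)
  -- Passing from `l`, `δ` to `M`, `g` costs factors `0.9999` and `1.001`, hence 99 in place of 100
  -- here and in the next two bounds.
  have hgap : ∀ n, n + 1 < N → 99 * ϰ * g (n + 1) ≤ g n := fun n hn => by
    have e1 := hgl n (by omega)
    have e2 := hgu (n + 1) hn
    have e3 := h1' (n + 1) (by omega) (by omega)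
    have e4 := mul_le_mul_of_nonneg_left e2 (by linarith : 0 ≤ ϰ)
    have e5 := mul_pos (by linarith : 0 < ϰ) (hδ (n + 1 + 1) (by omega) (by omega))
    linarith
  have hmoment : ∀ n, n + 1 < N → 99 * lam * (M n * g n) ≤ M (n + 1) * g (n + 1) := fun n hn => by
    have e1 : M n * g n ≤ l (n + 1) * (1.001 * chainDelta e (n + 1)) :=
      mul_le_mul (hMu n (by omega)) (hgu n (by omega)) (hgp n (by omega)).le
        (hl _ (by omega) (by omega)).le
    have e2 : 0.9999 * l (n + 1 + 1) * chainDelta e (n + 1 + 1) ≤ M (n + 1) * g (n + 1) :=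
      mul_le_mul (hMl _ hn) (hgl _ hn) (hδ _ (by omega) (by omega)).le (hMp _ hn).le
    have e3 := h2' (n + 1) (by omega) (by omega)
    have e4 := mul_le_mul_of_nonneg_left e1 (by linarith : 0 ≤ lam)
    have e5 : 0 < lam * (l (n + 1) * chainDelta e (n + 1)) := mul_pos (by linarith)
      (mul_pos (hl _ (by omega) (by omega)) (hδ _ (by omega) (by omega)))
    linarith
  have hmoment2 : ∀ n, n + 1 < N →
      99 * (M n * g n ^ 2) ≤ θ * (M (n + 1) * g (n + 1) ^ 2) := fun n hn => by
    have e1 : M n * g n ^ 2 ≤ l (n + 1) * (1.001 * chainDelta e (n + 1)) ^ 2 :=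
      mul_le_mul (hMu n (by omega))
        (pow_le_pow_left₀ (hgp n (by omega)).le (hgu n (by omega)) 2)
        (pow_pos (hgp n (by omega)) 2).le (hl _ (by omega) (by omega)).le
    have e2 : 0.9999 * l (n + 1 + 1) * chainDelta e (n + 1 + 1) ^ 2 ≤
        M (n + 1) * g (n + 1) ^ 2 :=
      mul_le_mul (hMl _ hn)
        (pow_le_pow_left₀ (hδ _ (by omega) (by omega)).le (hgl _ hn) 2)
        (pow_pos (hδ _ (by omega) (by omega)) 2).le (hMp _ hn).le
    have e3 := h3' (n + 1) (by omega) (by omega)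
    have e4 := mul_le_mul_of_nonneg_left e2 hθ0.le
    have e5 : 0 < l (n + 1) * chainDelta e (n + 1) ^ 2 :=
      mul_pos (hl _ (by omega) (by omega)) (pow_pos (hδ _ (by omega) (by omega)) 2)
    nlinarith
  have hstring : IsSparseString N M g :=
    { mass_pos := hMp
      gap_pos := hgp
      gap := fun n hn => by
        have := hgap n hn
        have := hgp (n + 1) hn
        nlinarith
      moment := fun n hn => by
        have := hmoment n hn
        have := mul_pos (hMp n (by omega)) (hgp n (by omega))
        nlinarith }
  -- The bound on `j` sits inside the existential so that `τ` is a total function, with an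
  -- irrelevant value for `j ≥ N`.
  have hex : ∀ j, ∃ z, j < N →
      1 / 2 ≤ z * (M j * g j) ∧ z * (M j * g j) ≤ 2 ∧ amp M g z N = 0 := fun j => by
    by_cases hj : j < N
    · obtain ⟨z, hz⟩ := hstring.exists_eigenvalue hj
      exact ⟨z, fun _ => hz⟩
    · exact ⟨0, fun h => absurd h hj⟩
  choose τ hτ using hex
  set S : ℕ → ℝ := fun j => ∑ k ∈ Finset.range N, M k * amp M g (τ j) k ^ 2 with hS
  have hSb : ∀ j < N, 0.9 * M j ≤ S j ∧ S j ≤ 2.1 * M j := fun j hj =>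
    hstring.sum_bounds hj (hτ j hj).1 (hτ j hj).2.1 (hτ j hj).2.2
  have hSp : ∀ j < N, 0 < S j := fun j hj => by
    have := (hSb j hj).1
    have := hMp j hj
    linarith
  have hl1 := hl 1 le_rfl (by omega)
  have hτp : ∀ j < N, 0 < τ j := fun j hj => by
    have := (hτ j hj).1
    have := mul_pos (hMp j hj) (hgp j hj)
    by_contra hcon
    nlinarith
  have hstep : ∀ j, j + 1 < N → τ j > lam * τ (j + 1) ∧
      l 1 / S j / τ j > ϰ * (l 1 / S (j + 1) / τ (j + 1)) ∧
      l 1 / S j / τ j ^ 2 < θ * (l 1 / S (j + 1) / τ (j + 1) ^ 2) := fun j hj =>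
    have hj' : j < N := by omega
    lacunary_step (by linarith) hθ0 hl1 (hMp j hj') (hgp j hj') (hMp _ hj)
      (hgp _ hj) (hτ j hj').1 (hτ j hj').2.1 (hτ _ hj).1 (hτ _ hj).2.1 (hSb j hj').1
      (hSb j hj').2 (hSb _ hj).1 (hSb _ hj).2 (hgap j hj) (hmoment j hj) (hmoment2 j hj)
  have hanti : ∀ i j, i < j → j < N → τ j < τ i := by
    intro i j hij
    induction j, hij using Nat.le_induction with
    | base =>
      intro hj
      have := (hstep i hj).1
      have := hτp (i + 1) hj
      nlinarith
    | succ j hij ih =>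
      intro hj
      have := (hstep j hj).1
      have := hτp (j + 1) hj
      have := ih (by omega)
      nlinarith
  have hinj : InjOn τ (Finset.range N) := by
    intro i hi j hj hij
    have hi := Finset.mem_range.1 hi
    have hj := Finset.mem_range.1 hj
    rcases lt_trichotomy i j with h | h | h
    · exact absurd hij (hanti i j h hj).ne'
    · exact h
    · exact absurd hij (hanti j i h hi).ne
  have hdot : ∀ k : Fin N, dotProduct (fun i : Fin N => chainVector l e (τ k) i)
      (fun i : Fin N => chainVector l e (τ k) i) = S k := fun k => by
    rw [dotProduct, Fin.sum_univ_eq_sum_range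
      (fun i => chainVector l e (τ k) i * chainVector l e (τ k) i) N]
    exact Finset.sum_congr rfl fun i hi => chainVector_sq hl (Finset.mem_range.1 hi)
  obtain ⟨hint, a, b, ha, hf⟩ := hμ
  have hsum : ∀ z : ℂ, 0 < z.im → herglotz (chainJacobi N l e) z =
      ∑ k ∈ Finset.range N, ((l 1 / S k : ℝ) : ℂ) / ((τ k : ℂ) - z) := by
    intro z hz
    rw [herglotz_eq_sum (J := chainJacobi N l e) (jacobiMatrix_transpose N _ _)
      (τ := fun k : Fin N => τ k) (v := fun k i => chainVector l e (τ k) i) _ _ _ hz,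
      ← Fin.sum_univ_eq_sum_range (fun k => ((l 1 / S k : ℝ) : ℂ) / ((τ k : ℂ) - z)) N]
    · refine Finset.sum_congr rfl fun k _ => ?_
      have h0 : chainVector l e (τ k) ((0 : Fin N) : ℕ) ^ 2 = l 1 := by
        rw [Fin.val_zero, chainVector, amp_zero, he1]
        simp [hl1.le]
      rw [hdot k, h0]
    · exact fun i j hij => Fin.ext (hinj (by simp) (by simp) hij)
    · exact fun k => chainJacobi_mulVec hl hdir (hτ k k.2).2.2
    · intro k
      rw [hdot k]
      exact hSp k k.2
  have hdirac := measure_eq_sum_dirac (s := Finset.range N) (τ := τ) (w := fun k => l 1 / S k)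
    hint ha (fun k hk => (div_pos hl1 (hSp k (Finset.mem_range.1 hk))).le) hinj
    (fun z hz => by rw [← hsum z hz]; exact hf z hz)
  -- Eigenvalues decrease along the string, so the order is reversed; `N - k` also shifts the index
  -- from `0, …, N - 1` to `1, …, N`.
  refine ⟨fun k => τ (N - k), fun k => l 1 / S (N - k), ?_, ?_, ?_⟩
  · intro k hk
    obtain ⟨hk1, hk2⟩ := Finset.mem_Icc.1 hk
    exact ⟨hτp _ (by omega), div_pos hl1 (hSp _ (by omega))⟩
  · rw [hdirac]
    refine Finset.sum_bij' (fun k _ => N - k) (fun k _ => N - k) ?_ ?_ ?_ ?_ ?_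
    · intro k hk
      have := Finset.mem_range.1 hk
      exact Finset.mem_Icc.2 ⟨by omega, by omega⟩
    · intro k hk
      have := Finset.mem_Icc.1 hk
      exact Finset.mem_range.2 (by omega)
    · intro k hk
      have := Finset.mem_range.1 hk
      omega
    · intro k hk
      have := Finset.mem_Icc.1 hk
      omega
    · intro k hk
      have := Finset.mem_range.1 hk
      simp only [show N - (N - k) = k by omega]
  · intro k hk hkN
    have := hstep (N - (k + 1)) (by omega)
    rwa [show N - (k + 1) + 1 = N - k by omega] at this
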